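/- **Model.** Fix $\lambda>0$ and $\alpha\in(0,1)$. For $n\ge 1$ consider $n$ parallel infinite-server pools with unit-mean exponential service times and Poisson arrivals of rate $n\lambda$. Let $q_n(t,i)$ be the fraction of pools with at least $i$ tasks at time $t$ and let $\ell_n(t)\in\mathbb N$ be the threshold. Write $Q=\{q\in[0,1]^{\mathbb N}: q(i+1)\le q(i)\le q(0)=1\}$. An arriving task which finds state $(q,\ell)$ is sent to a pool chosen uniformly among those with fewer than $\ell$ tasks if $q(\ell)<1$; to a pool with exactly $\ell$ tasks if $q(\ell)=1$ and $q(\ell+1)<1$; and to a pool chosen uniformly among all pools if $q(\ell+1)=1$. Right after an arrival which finds $(q,\ell)$, the threshold is increased by one if $q(\ell+1)\ge 1-1/n$, and decreased by one if $q(\ell)\le\alpha$ (if both hold, which is possible only for small $n$, it does not change). All systems are constructed on one probability space from independent primitives: a Poisson process $\mathcal N_\lambda$ of rate $\lambda$, unit-rate Poisson processes $\mathcal N_1^i$, i.i.d. uniform variables $U_j$ on $[0,1)$, and initial conditions $(q_n(0),\ell_n(0))_{n\ge1}$ independent of the other primitives, with $q_n(0)\in Q$, $nq_n(0,i)\in\mathbb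 N$ and $\sum_i q_n(0,i)<\infty$. Namely, with $\sigma_{nj}$ the $j$-th jump time of $\mathcal N_\lambda(n\,\cdot)$, almost surely $q_n(t)\in Q$ for all $t\ge 0$ and, for all $t\ge 0$ and $i\ge1$, $$q_n(t,i)=q_n(0,i)+\frac1n\sum_{j=1}^{\mathcal N_\lambda(nt)} r_{ij}\big(q_n(\sigma_{nj}^-),\ell_n(\sigma_{nj}^-)\big)-\frac1n\mathcal N_1^i\Big(n\int_0^t i\,[q_n(s,i)-q_n(s,i+1)]\,ds\Big),$$ where $r_{ij}(q,\ell)\in\{0,1\}$ indicates that the $j$-th task goes to a pool with exactly $i-1$ tasks: for $i-1<\ell$ it is $1$ iff $q(\ell)<1$ and $U_j\in\big[\tfrac{1-q(i-1)}{1-q(\ell)},\tfrac{1-q(i)}{1-q(\ell)}\big)$; for $i-1=\ell$ it is $1$ iff $q(\ell)=1$ and $q(\ell+1)<1$; for $i-1>\ell$ it is $1$ iff $q(\ell+1)=1$ and $U_j\in[1-q(i-1),1-q(i))$. Also, for all $t\ge 0$, $$\ell_n(t)=\ell_n(0)+\sum_{j=1}^{\mathcal N_\lambda(nt)}\Big[\mathbf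 1\{q_n(\sigma_{nj}^-,\ell_n(\sigma_{nj}^-)+1)\ge 1-\tfrac1n\}-\mathbf 1\{q_n(\sigma_{nj}^-,\ell_n(\sigma_{nj}^-))\le\alpha\}\Big].$$ Assume that almost surely $q_n(0,i)\to q(0,i)$ for all $i$ and $\ell_n(0)\to\ell(0)$ as $n\to\infty$, where the (possibly random) limits satisfy $q(0)\in Q$, $u(0):=\sum_{i\ge1}q(0,i)<\infty$, $q(0,\ell(0))>\alpha$ and $q(0,\ell(0)+1)<1$. Let $q^*(i)=1$ for $i\le\lfloor\lambda\rfloor$, $q^*(\lfloor\lambda\rfloor+1)=\lambda-\lfloor\lambda\rfloor$, $q^*(i)=0$ for $i>\lfloor\lambda\rfloor+1$, and $$\bar t_{\rm eq}=\begin{cases}\log\frac{\lambda}{\lambda-\lfloor\lambda\rfloor}&\text{if }u(0)\le\lambda,\\ \Big[\log\frac{u(0)-\lambda}{\alpha\lceil\lambda\rceil-\lambda}\Big]^++\log\frac{\lambda}{\lambda-\lfloor\lambda\rfloor}&\text{if }u(0)>\lambda.\end{cases}$$ **Corollary.** Suppose that $\lambda\notin\mathbb N$ and $\lambda/(\lfloor\lambda\rfloor+1)<\alpha$.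 There is a constant $c>0$, depending only on $\alpha$, $\lambda$ and $u(0)$, such that, almost surely, for all $T\ge\bar t_{\rm eq}$: 1. $\lim_{n\to\infty}\sup_{t\in[\bar t_{\rm eq}+\delta,T]}|\ell_n(t)-\lfloor\lambda\rfloor|=0$ for all $\delta>0$. This also holds with $\delta=0$, unless either $\lambda>1$ and $u(0)=0$, or $\lambda<1$, $\ell(0)=1$ and $q(0,2)=0$. 2. $\lim_{n\to\infty}\sup_{t\in[\bar t_{\rm eq},T]}|q_n(t,i)-q^*(i)|=0$ for all $i\le\lfloor\lambda\rfloor$. 3. $\limsup_{n\to\infty}\sup_{t\in[\bar t_{\rm eq},T]}|q_n(t,i)-q^*(i)|\,e^{t-\bar t_{\rm eq}}\le c$ for all $i\ge\lceil\lambda\rceil$. (The supremum over an empty interval is zero.) -/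

import Mathlib

open MeasureTheory ProbabilityTheory Filter Topology
open scoped NNReal ENNReal

namespace LoadBalancing

/-! ### Stochastic primitives -/

/-- `N` is (a version with counting paths of) a homogeneous Poisson process of the given rate:
it starts at zero, its paths are almost surely nondecreasing and right-continuous, and its
increments are independent, the one over `(s, t]` being Poisson with mean `rate * (t - s)`. -/
structure IsPoissonProcess {Ω : Type*} [MeasurableSpace Ω]
    (N : ℝ≥0 → Ω → ℕ) (rate : ℝ≥0) (P : Measure Ω) : Prop where
  measurable : ∀ t, Measurable (N t)
  start_zero : ∀ᵐ ω ∂P, N 0 ω = 0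
  monotone : ∀ᵐ ω ∂P, Monotone fun t => N t ω
  rightContinuous : ∀ᵐ ω ∂P, ∀ t, ContinuousWithinAt (fun s => N s ω) (Set.Ici t) t
  indepIncrements : HasIndepIncrements N P
  law : ∀ s t, s ≤ t →
    HasLaw (fun ω => N t ω - N s ω) (poissonMeasure (rate * (t - s))) P

/-- The independent sources of randomness: the arrival process, the potential departure process
of each level `i`, the selection variable of each task `j`, and all the initial conditions
together. -/
inductive Source where
  | arrivals
  | departures (i : ℕ)
  | selection (j : ℕ)
  | initial

/-- The σ-algebra generated by a source of randomness. Here `q0 n` and `ell0 n` are the initial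
occupancy and the initial threshold of the system with `n` server pools, `n ≥ 1`. -/
@[reducible] def Source.sigma {Ω : Type*} (N : ℝ≥0 → Ω → ℕ) (D : ℕ → ℝ≥0 → Ω → ℕ) (U : ℕ → Ω → ℝ)
    (q0 : ℕ → Ω → ℕ → ℝ) (ell0 : ℕ → Ω → ℕ) : Source → MeasurableSpace Ω
  | .arrivals => ⨆ t : ℝ≥0, MeasurableSpace.comap (N t) inferInstance
  | .departures i => ⨆ t : ℝ≥0, MeasurableSpace.comap (D i t) inferInstance
  | .selection j => MeasurableSpace.comap (U j) inferInstance
  | .initial => ⨆ (n : ℕ) (_ : 1 ≤ n),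
      MeasurableSpace.comap (q0 n) inferInstance ⊔ MeasurableSpace.comap (ell0 n) inferInstance

/-! ### Occupancy states and the threshold policy -/

/-- Occupancy states: `q i` is the fraction of server pools with at least `i` tasks. -/
def occupancySpace : Set (ℕ → ℝ) :=
  {q | q 0 = 1 ∧ ∀ i, 0 ≤ q i ∧ q (i + 1) ≤ q i}

/-- The total number of tasks per server pool, `∑_{i ≥ 1} q i`. -/
noncomputable def totalMass (q : ℕ → ℝ) : ℝ := ∑' i : ℕ, q (i + 1)

open Classical in
/-- The dispatching decision in occupancy state `q` with threshold `ell`: for a task with selection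
variable `x ∈ [0, 1)`, the value is `1` if the task is sent to a server pool with exactly `k` tasks,
and `0` otherwise.
* If `q ell < 1`, the pool is uniform among those with fewer than `ell` tasks.
* If `q ell = 1` and `q (ell + 1) < 1`, the pool has exactly `ell` tasks.
* If `q (ell + 1) = 1`, the pool is uniform among all (all have more than `ell` tasks). -/
noncomputable def routing (q : ℕ → ℝ) (ell k : ℕ) (x : ℝ) : ℝ :=
  if k < ell then
    if q ell < 1 ∧
        x ∈ Set.Ico ((1 - q k) / (1 - q ell)) ((1 - q (k + 1)) / (1 - q ell)) then 1 else 0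
  else if k = ell then
    if q ell = 1 ∧ q (ell + 1) < 1 then 1 else 0
  else
    if q (ell + 1) = 1 ∧ x ∈ Set.Ico (1 - q k) (1 - q (k + 1)) then 1 else 0

/-! ### The system with `n` server pools

Below `N`, `D i` and `U` are sample paths of the arrival process, of the potential departure
process of level `i`, and of the selection variables. -/

/-- The number of arrivals up to time `t`, that is, `N (n t)`. -/
noncomputable def arrivalCount (n : ℕ) (N : ℝ≥0 → ℕ) (t : ℝ) : ℕ := N (n * t.toNNReal)

/-- The time of the `j`-th arrival (`j ≥ 1`), the `j`-th jump time of `t ↦ N (n t)`. -/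
noncomputable def arrivalTime (n : ℕ) (N : ℝ≥0 → ℕ) (j : ℕ) : ℝ :=
  sInf {t : ℝ | 0 ≤ t ∧ j ≤ arrivalCount n N t}

/-- The occupancy right before time `s`. -/
noncomputable def occupancyBefore (q : ℝ → ℕ → ℝ) (s : ℝ) : ℕ → ℝ :=
  fun i => Function.leftLim (fun t => q t i) s

/-- The threshold right before time `s`. -/
noncomputable def thresholdBefore (ell : ℝ → ℕ) (s : ℝ) : ℕ := Function.leftLim ell s

/-- `1 / n` times the number of tasks which, up to time `t`, were sent to a server pool
with exactly `i - 1` tasks; zero for `i = 0`. -/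
noncomputable def arrivalTerm (n : ℕ) (N : ℝ≥0 → ℕ) (U : ℕ → ℝ)
    (q : ℝ → ℕ → ℝ) (ell : ℝ → ℕ) (t : ℝ) : ℕ → ℝ
  | 0 => 0
  | k + 1 => (1 / (n : ℝ)) * ∑ j ∈ Finset.Icc 1 (arrivalCount n N t),
      routing (occupancyBefore q (arrivalTime n N j)) (thresholdBefore ell (arrivalTime n N j))
        k (U j)

/-- `1 / n` times the number of departures up to time `t` from server pools with exactly `i` tasks:
`D i` run at the time-varying rate `n i (q i - q (i + 1))`; zero for `i = 0`. -/
noncomputable def departureTerm (n : ℕ) (D : ℕ → ℝ≥0 → ℕ) (q : ℝ → ℕ → ℝ) (t : ℝ) (i : ℕ) : ℝ :=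
  if i = 0 then 0
  else (1 / (n : ℝ)) *
    (D i (Real.toNNReal (n * ∫ s in (0 : ℝ)..t, (i : ℝ) * (q s i - q s (i + 1)))) : ℝ)

open Classical in
/-- The change of the threshold caused by an arrival that finds occupancy `q` and threshold `ell`:
`+1` if at least `n - 1` server pools have at least `ell + 1` tasks, `-1` if the fraction of server
pools with at least `ell` tasks is at most `α` (and the sum of both if both hold). -/
noncomputable def thresholdStep (n : ℕ) (α : ℝ) (q : ℕ → ℝ) (ell : ℕ) : ℤ :=
  (if 1 - 1 / (n : ℝ) ≤ q (ell + 1) then 1 else 0) - (if q ell ≤ α then 1 else 0)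

/-- `(q, ell)` is the sample path on `[0, ∞)` of the system with `n` server pools and dynamic
threshold, driven by the paths `N`, `D`, `U` and started from `q 0` and `ell 0`. Initially the
number of tasks in the system is finite and numbers of server pools are integers. -/
structure IsSystemPath (n : ℕ) (α : ℝ) (N : ℝ≥0 → ℕ) (D : ℕ → ℝ≥0 → ℕ) (U : ℕ → ℝ)
    (q : ℝ → ℕ → ℝ) (ell : ℝ → ℕ) : Prop where
  mem_occupancySpace : ∀ t, 0 ≤ t → q t ∈ occupancySpace
  initial_lattice : ∀ i, ∃ k : ℕ, (n : ℝ) * q 0 i = k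
  initial_summable : Summable (q 0)
  occupancy_eq : ∀ t, 0 ≤ t → ∀ i,
    q t i = q 0 i + arrivalTerm n N U q ell t i - departureTerm n D q t i
  threshold_eq : ∀ t, 0 ≤ t →
    (ell t : ℤ) = ell 0 + ∑ j ∈ Finset.Icc 1 (arrivalCount n N t),
      thresholdStep n α (occupancyBefore q (arrivalTime n N j))
        (thresholdBefore ell (arrivalTime n N j))

/-! ### Even distribution of the load and the settling time -/

/-- The even distribution of the load `q*`. -/
noncomputable def evenLoad (lam : ℝ) (i : ℕ) : ℝ :=
  if i ≤ ⌊lam⌋₊ then 1 else if i = ⌊lam⌋₊ + 1 then lam - ⌊lam⌋₊ else 0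

/-- The bound on the settling time of the threshold, as a function of the initial
total mass `u`. -/
noncomputable def settlingBound (α lam u : ℝ) : ℝ :=
  if u ≤ lam then Real.log (lam / (lam - ⌊lam⌋₊))
  else max (Real.log ((u - lam) / (α * ⌈lam⌉₊ - lam))) 0 + Real.log (lam / (lam - ⌊lam⌋₊))

/-- The initial states from which the bound on the settling time is attained, so that the limiting
threshold has its last jump exactly at that time: either `lam > 1` and the system is empty, or
`lam < 1`, the threshold is one and no server pool has more than one task. -/
def IsTightInitialState (lam : ℝ) (q : ℕ → ℝ) (ell : ℕ) : Prop :=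
  (1 < lam ∧ totalMass q = 0) ∨ (lam < 1 ∧ ell = 1 ∧ q 2 = 0)

/-- The supremum of `|f|` over `[a, b]`, with values in `[0, ∞]` (and zero if `b < a`). -/
noncomputable def supAbs (f : ℝ → ℝ) (a b : ℝ) : ℝ≥0∞ :=
  ⨆ t ∈ Set.Icc a b, ENNReal.ofReal |f t|

end LoadBalancing

namespace LoadBalancing

/-! ### Paths of Poisson processes -/

/-! Outside a null set the argument is deterministic. By the strong law and monotonicity, the scaled
Poisson paths stay uniformly close to their means on bounded intervals, and they have unit jumps
(`IsCountingPath`). On such a path one follows the truncated masses `mass`, the number of tasks per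
pool at levels `1, …, a`. They gain the tasks sent to pools with fewer than `a` tasks and lose mass
at rate `mass q a - a * q (a + 1)`, which is at most `mass q a`. Whenever all tasks are eligible for
such pools, comparison with `y' = lam - y` (`relaxation_le_of_barrier`) bounds the mass from below.

The obstacle is overflow: tasks that find every pool above the threshold may go anywhere. Each of
them raises the threshold. Raising it across an edge needs an almost full level, lowering it across
the same edge needs that level to be at most `α`, and levels are almost Lipschitz in time; so on a
bounded interval the number of raises is bounded uniformly in `n` (`exists_card_overflow_le`),
negligible after division by `n`.

Let `m = ⌊lam⌋` and let `u` be the initial mass. For large `a` the truncated mass follows `lam + (u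
- lam) * exp (-t)`. Once this is below `α * (m + 1)`, level `m + 1` is at most `α`, so boundedly
many arrivals bring the threshold down to `m` (`eventually_threshold_le_of_onset`). From then on
every task goes below level `m` unless that level is full, so the mass up to `m` dominates the
solution started from zero, which reaches `m` after time `log (lam / (lam - m))`. With level `m`
full, the threshold cannot drop below `m`, nor stay below it, because inflow `lam > m` would
overfill the lower levels (`eventually_threshold_eq`). Levels above `m + 1` get almost no tasks and
drain at rate at least one; with the convergence of the total mass this gives the exponential bound.

Settling exactly at the bound needs slack. If `m ≥ 1`, a positive `q 1` gives the filling phase a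
head start. If `lam < 1` and `q 2 > 0`, level one falls below the total mass by a fixed amount, so
it reaches `α` early; if `q 2 = 0`, the threshold starts at zero and is never raised. -/

theorem hasSum_poisson_mean (r : ℝ≥0) :
    HasSum (fun n : ℕ => Real.exp (-r) * (r : ℝ) ^ n / (n.factorial : ℝ) * (n : ℝ)) r := by
  rw [← hasSum_nat_add_iff' 1]
  have h := (hasSum_one_poissonMeasure r).mul_left (r : ℝ)
  simp only [Finset.range_one, Finset.sum_singleton, Nat.cast_zero, mul_zero, sub_zero]
  rw [mul_one] at h
  refine h.congr_fun ?_
  intro n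
  rw [Nat.factorial_succ]
  push_cast
  have h1 : ((n.factorial : ℕ) : ℝ) ≠ 0 := by positivity
  have h2 : (n : ℝ) + 1 ≠ 0 := by positivity
  field_simp
  ring

theorem integrable_cast_poissonMeasure (r : ℝ≥0) :
    Integrable (fun n : ℕ => (n : ℝ)) (poissonMeasure r) := by
  rw [integrable_poissonMeasure_iff]
  simpa using (hasSum_poisson_mean r).summable

theorem integral_cast_poissonMeasure (r : ℝ≥0) :
    ∫ n : ℕ, (n : ℝ) ∂(poissonMeasure r) = r :=
  (hasSum_integral_poissonMeasure (integrable_cast_poissonMeasure r)).unique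
    (by simpa using hasSum_poisson_mean r)

/-- The probability is `1 - exp (-r) * (1 + r)`, and `exp (-r) ≥ 1 - r`. The quadratic order is what
makes double jumps disappear under mesh refinement. -/
theorem poissonMeasure_two_le (r : ℝ≥0) :
    poissonMeasure r {n | 2 ≤ n} ≤ ENNReal.ofReal ((r : ℝ) ^ 2) := by
  have hset : {n : ℕ | 2 ≤ n} = ({0, 1} : Set ℕ)ᶜ := by
    ext n; simp; omega
  have hreal : (poissonMeasure r).real {n | 2 ≤ n} ≤ (r : ℝ) ^ 2 := by
    rw [hset, probReal_compl_eq_one_sub (by measurability)]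
    have : (poissonMeasure r).real ({0, 1} : Set ℕ) = Real.exp (-r) + Real.exp (-r) * r := by
      rw [Set.insert_eq, measureReal_union (by simp) (by measurability),
        poissonMeasure_real_singleton, poissonMeasure_real_singleton]
      simp
    rw [this]
    have h1 : 1 - (r : ℝ) ≤ Real.exp (-r) := by linarith [Real.add_one_le_exp (-(r : ℝ))]
    nlinarith [r.coe_nonneg]
  rw [← ofReal_measureReal]
  exact ENNReal.ofReal_le_ofReal hreal

/-- A discrete intermediate value theorem. -/
theorem exists_eq_of_le_of_succ_le {g : ℕ → ℕ} (h0 : g 0 = 0) {K : ℕ}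
    (hg : ∀ k < K, g (k + 1) ≤ g k + 1) {v : ℕ} (hv : v ≤ g K) : ∃ k ≤ K, g k = v := by
  induction K with
  | zero => exact ⟨0, le_rfl, by omega⟩
  | succ K ih =>
    by_cases h : v ≤ g K
    · obtain ⟨k, hk, e⟩ := ih (fun k hk => hg k (by omega)) h
      exact ⟨k, by omega, e⟩
    · exact ⟨K + 1, le_rfl, by have := hg K (by omega); omega⟩

section Poisson

variable {Ω : Type*} [MeasurableSpace Ω] {P : Measure Ω}
  {N : ℝ≥0 → Ω → ℕ} {rate : ℝ≥0}

theorem IsPoissonProcess.measure_two_le (h : IsPoissonProcess N rate P) {s t : ℝ≥0} (hst : s ≤ t) :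
    P {ω | 2 ≤ N t ω - N s ω} ≤ ENNReal.ofReal (((rate * (t - s) : ℝ≥0) : ℝ) ^ 2) := by
  have := (h.law s t hst).measure_eq (p := fun n => 2 ≤ n) (by measurability)
  rw [this]
  exact poissonMeasure_two_le _

/-- Unit jumps are derived from the Poisson law. Cutting `[0, K]` into cells of length `1 / (n +
1)`, the probability that some cell has increment at least two is of order `1 / n`; on a mesh
without such a cell no value is skipped. -/
theorem IsPoissonProcess.ae_le_imp_mem_range (h : IsPoissonProcess N rate P) (K : ℕ) :
    ∀ᵐ ω ∂P, ∀ v ≤ N K ω, ∃ t, N t ω = v := by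
  set bad : ℕ → Set Ω := fun n =>
    ⋃ k ∈ Finset.range (K * (n + 1)),
      {ω | 2 ≤ N (((k + 1 : ℕ) : ℝ≥0) / (n + 1)) ω - N ((k : ℝ≥0) / (n + 1)) ω} with hbad
  have hP : ∀ n, P (bad n) ≤ ENNReal.ofReal (K * rate ^ 2 * (1 / ((n : ℝ) + 1))) := by
    intro n
    refine (measure_biUnion_finset_le _ _).trans ?_
    have hk : ∀ k ∈ Finset.range (K * (n + 1)),
        P {ω | 2 ≤ N (((k + 1 : ℕ) : ℝ≥0) / (n + 1)) ω - N ((k : ℝ≥0) / (n + 1)) ω}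
          ≤ ENNReal.ofReal (((rate : ℝ) / (n + 1)) ^ 2) := by
      intro k _
      have hle : (k : ℝ≥0) / (n + 1) ≤ ((k + 1 : ℕ) : ℝ≥0) / (n + 1) := by
        gcongr; simp
      refine (h.measure_two_le hle).trans (le_of_eq ?_)
      congr 2
      rw [NNReal.coe_mul, NNReal.coe_sub hle]
      push_cast
      ring
    refine (Finset.sum_le_sum hk).trans ?_
    rw [Finset.sum_const, Finset.card_range, nsmul_eq_mul, ← ENNReal.ofReal_natCast,
      ← ENNReal.ofReal_mul (by positivity)]
    apply ENNReal.ofReal_le_ofReal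
    push_cast
    have : (n : ℝ) + 1 ≠ 0 := by positivity
    apply le_of_eq
    field_simp
  -- One good mesh per path suffices, so it is enough that the intersection of the bad events is
  -- null.
  have hzero : P (⋂ n, bad n) = 0 := by
    have hlim : Tendsto (fun n : ℕ => ENNReal.ofReal (K * rate ^ 2 * (1 / ((n : ℝ) + 1)))) atTop
        (𝓝 0) := by
      rw [← ENNReal.ofReal_zero]
      apply ENNReal.tendsto_ofReal
      simpa using (tendsto_one_div_add_atTop_nhds_zero_nat (𝕜 := ℝ)).const_mul ((K : ℝ) * rate ^ 2)
    exact le_antisymm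
      (ge_of_tendsto' hlim fun n => (measure_mono (Set.iInter_subset _ n)).trans (hP n)) bot_le
  have hae : ∀ᵐ ω ∂P, ω ∉ ⋂ n, bad n := measure_eq_zero_iff_ae_notMem.1 hzero
  filter_upwards [hae, h.start_zero] with ω hω h0 v hv
  simp only [Set.mem_iInter, not_forall] at hω
  obtain ⟨n, hn⟩ := hω
  simp only [hbad, Set.mem_iUnion, Set.mem_ofPred_eq, not_exists, Finset.mem_range] at hn
  obtain ⟨k, -, hk⟩ := exists_eq_of_le_of_succ_le (g := fun k => N ((k : ℝ≥0) / (n + 1)) ω)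
    (K := K * (n + 1)) (v := v) (by simpa using h0)
    (fun k hk => by have := hn k hk; omega)
    (by
      have e : ((K * (n + 1) : ℕ) : ℝ≥0) / (n + 1) = K := by
        push_cast; field_simp
      simpa only [e] using hv)
  exact ⟨_, hk⟩

/-- The strong law of large numbers for the increments over unit intervals, whose sum telescopes. -/
theorem IsPoissonProcess.ae_tendsto_nat (h : IsPoissonProcess N rate P) :
    ∀ᵐ ω ∂P, Tendsto (fun k : ℕ => (N k ω : ℝ) / k) atTop (𝓝 rate) := by
  set X : ℕ → Ω → ℝ := fun i ω => ((N ((i + 1 : ℕ) : ℝ≥0) ω - N (i : ℝ≥0) ω : ℕ) : ℝ) with hX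
  have hlaw : ∀ i : ℕ, HasLaw (fun ω => N ((i + 1 : ℕ) : ℝ≥0) ω - N (i : ℝ≥0) ω)
      (poissonMeasure rate) P := by
    intro i
    have := h.law (i : ℝ≥0) ((i + 1 : ℕ) : ℝ≥0) (by simp)
    have e : rate * (((i + 1 : ℕ) : ℝ≥0) - (i : ℝ≥0)) = rate := by
      push_cast; simp
    rwa [e] at this
  have hlawX : ∀ i, HasLaw (X i) ((poissonMeasure rate).map (Nat.cast : ℕ → ℝ)) P := by
    intro i
    refine HasLaw.comp (Y := (Nat.cast : ℕ → ℝ)) ?_ (hlaw i)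
    exact ⟨by fun_prop, rfl⟩
  have hident : ∀ i, IdentDistrib (X i) (X 0) P P := fun i =>
    ⟨(hlawX i).aemeasurable, (hlawX 0).aemeasurable, by
      rw [(hlawX i).map_eq, (hlawX 0).map_eq]⟩
  have hint : Integrable (X 0) P := by
    have h1 := integrable_cast_poissonMeasure rate
    rw [← (hlaw 0).map_eq] at h1
    exact (integrable_map_measure (by fun_prop) (hlaw 0).aemeasurable).1 h1
  have hindep : Pairwise (Function.onFun (fun f g => IndepFun f g P) X) := by
    have h1 := h.indepIncrements.nat (t := fun i : ℕ => (i : ℝ≥0)) Nat.mono_cast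
    intro i j hij
    exact (h1.indepFun hij).comp (φ := (Nat.cast : ℕ → ℝ)) (ψ := (Nat.cast : ℕ → ℝ))
      (by fun_prop) (by fun_prop)
  have hmean : ∫ ω, X 0 ω ∂P = rate := by
    have := (hlaw 0).integral_comp (f := fun n : ℕ => (n : ℝ)) (by fun_prop)
    rw [integral_cast_poissonMeasure] at this
    exact this
  have hs := strong_law_ae_real X hint hindep hident
  filter_upwards [hs, h.start_zero, h.monotone] with ω hω h0 hm
  rw [hmean] at hω
  refine hω.congr fun k => ?_
  congr 1
  induction k with
  | zero => simp [h0]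
  | succ k ih =>
    rw [Finset.sum_range_succ, ih, hX]
    have : N (k : ℝ≥0) ω ≤ N ((k + 1 : ℕ) : ℝ≥0) ω := hm (by simp)
    simp only []
    rw [Nat.cast_sub this]
    ring

end Poisson

/-- A counting path with unit jumps and asymptotic rate `rate`. -/
structure IsCountingPath (f : ℝ≥0 → ℕ) (rate : ℝ) : Prop where
  zero : f 0 = 0
  mono : Monotone f
  rightContinuous : ∀ t, ContinuousWithinAt f (Set.Ici t) t
  surjective : Function.Surjective f
  eventually_abs_sub_le : ∀ T ε : ℝ, 0 < ε → ∀ᶠ n : ℕ in atTop, ∀ s : ℝ≥0, (s : ℝ) ≤ n * T →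
    |(f s : ℝ) - rate * s| ≤ ε * n

/-- Monotonicity sandwiches `f s` between its values at neighbouring integers, which are close to
`rate * k` for large `k`. The remaining bounded range of `s` contributes a constant, absorbed by `ε
* n`. -/
theorem eventually_abs_sub_le_of_tendsto {f : ℝ≥0 → ℕ} (hf : Monotone f) {rate : ℝ}
    (hr : 0 ≤ rate) (hlim : Tendsto (fun k : ℕ => (f k : ℝ) / k) atTop (𝓝 rate))
    (T : ℝ) {ε : ℝ} (hε : 0 < ε) :
    ∀ᶠ n : ℕ in atTop, ∀ s : ℝ≥0, (s : ℝ) ≤ n * T → |(f s : ℝ) - rate * s| ≤ ε * n := by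
  -- A slope error of `η` over times up to `n * |T|` costs at most half of `ε * n`.
  set η : ℝ := ε / (2 * (|T| + 1)) with hη
  have hT : 0 < |T| + 1 := by positivity
  have hη0 : 0 < η := by positivity
  have hηT : η * (|T| + 1) = ε / 2 := by rw [hη]; field_simp
  obtain ⟨k₀, hk₀⟩ := (Metric.tendsto_atTop.1 hlim) η hη0
  have hk : ∀ k : ℕ, k₀ ≤ k → 1 ≤ k → |(f k : ℝ) - rate * k| ≤ η * k := by
    intro k h1 h2
    have hkpos : (0 : ℝ) < k := by exact_mod_cast h2
    have := (hk₀ k h1).le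
    rw [Real.dist_eq] at this
    have e : (f k : ℝ) - rate * k = ((f k : ℝ) / k - rate) * k := by field_simp
    rw [e, abs_mul, abs_of_pos hkpos]
    gcongr
  set S : ℝ≥0 := ((k₀ + 1 : ℕ) : ℝ≥0) with hS
  filter_upwards [eventually_ge_atTop (⌈(2 * (rate + η + (f S : ℝ) + rate * S)) / ε⌉₊ + 1)]
    with n hn s hs
  have hnε : 2 * (rate + η + (f S : ℝ) + rate * S) ≤ ε * n := by
    have h1 := Nat.le_ceil ((2 * (rate + η + (f S : ℝ) + rate * S)) / ε)
    have h2 : ((⌈(2 * (rate + η + (f S : ℝ) + rate * S)) / ε⌉₊ : ℕ) : ℝ) ≤ n := by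
      exact_mod_cast (by omega)
    have h3 := h1.trans h2
    rw [div_le_iff₀ hε] at h3
    linarith
  have hfS : (0 : ℝ) ≤ f S := by positivity
  have hrS : 0 ≤ rate * S := by positivity
  have hn0 : (0 : ℝ) ≤ n := by positivity
  rcases le_or_gt s S with hsS | hsS
  · have h1 : (f s : ℝ) ≤ f S := by exact_mod_cast hf hsS
    have h2 : rate * s ≤ rate * S := by gcongr
    have h3 : 0 ≤ rate * (s : ℝ) := by positivity
    have h4 : (0 : ℝ) ≤ f s := by positivity
    rw [abs_le]
    constructor <;> linarith
  · set k := ⌊s⌋₊ with hkdef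
    have hks : (k : ℝ≥0) ≤ s := Nat.floor_le (by positivity)
    have hsk : s < ((k + 1 : ℕ) : ℝ≥0) := by push_cast; exact Nat.lt_floor_add_one s
    have hkk : k₀ + 1 ≤ k := Nat.le_floor hsS.le
    have hb1 := hk k (by omega) (by omega)
    have hb2 := hk (k + 1) (by omega) (by omega)
    have hf1 : (f k : ℝ) ≤ f s := by exact_mod_cast hf hks
    have hf2 : (f s : ℝ) ≤ f ((k + 1 : ℕ) : ℝ≥0) := by exact_mod_cast hf hsk.le
    have hks' : (k : ℝ) ≤ s := by exact_mod_cast hks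
    have hsk' : (s : ℝ) < k + 1 := by exact_mod_cast hsk
    have hsT : (s : ℝ) ≤ n * |T| := hs.trans (by gcongr; exact le_abs_self T)
    have hηs : η * s ≤ ε / 2 * n := by
      calc η * s ≤ η * (n * |T|) := by gcongr
        _ ≤ η * (|T| + 1) * n := by nlinarith
        _ = ε / 2 * n := by rw [hηT]
    rw [abs_le] at hb1 hb2 ⊢
    push_cast at hb2
    have h5 : η * k ≤ η * s := by gcongr
    have h6 : rate * k ≤ rate * s := by gcongr
    have h7 : rate * s ≤ rate * (k + 1) := by gcongr
    push_cast at hf2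
    constructor
    · linarith [hb1.1]
    · linarith [hb2.2]

theorem IsPoissonProcess.ae_isCountingPath {Ω : Type*} [MeasurableSpace Ω] {P : Measure Ω}
    [IsProbabilityMeasure P] {N : ℝ≥0 → Ω → ℕ} {rate : ℝ≥0}
    (h : IsPoissonProcess N rate P) (hr : 0 < rate) :
    ∀ᵐ ω ∂P, IsCountingPath (fun t => N t ω) rate := by
  filter_upwards [h.start_zero, h.monotone, h.rightContinuous, h.ae_tendsto_nat,
    ae_all_iff.2 h.ae_le_imp_mem_range] with ω h0 hm hc hl hrange
  refine ⟨h0, hm, hc, ?_, fun T ε hε => eventually_abs_sub_le_of_tendsto hm hr.le hl T hε⟩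
  intro v
  have hr' : (0 : ℝ) < rate := hr
  have htop : Tendsto (fun k : ℕ => (N k ω : ℝ)) atTop atTop := by
    refine (hl.pos_mul_atTop hr' tendsto_natCast_atTop_atTop).congr' ?_
    filter_upwards [eventually_ge_atTop 1] with k hk
    have : (0 : ℝ) < k := by exact_mod_cast hk
    field_simp
  obtain ⟨K, hK⟩ := (htop.eventually_ge_atTop (v : ℝ)).exists
  exact hrange K v (by exact_mod_cast hK)

theorem ae_mem_Ico_of_isUniform {Ω : Type*} [MeasurableSpace Ω] {P : Measure Ω}
    [IsProbabilityMeasure P] {X : Ω → ℝ} (hX : Measurable X)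
    (h : pdf.IsUniform X (Set.Ico 0 1) P volume) : ∀ᵐ ω ∂P, X ω ∈ Set.Ico (0 : ℝ) 1 := by
  have h1 := h.measure_preimage (by simp) (by simp) (measurableSet_Ico (a := (0 : ℝ)) (b := 1))
  simp only [Set.inter_self, Real.volume_Ico, sub_zero, ENNReal.ofReal_one, div_one] at h1
  exact (prob_compl_eq_zero_iff (hX measurableSet_Ico)).2 h1

/-! ### Elementary facts about the dispatching rule -/

theorem occupancySpace_antitone {q : ℕ → ℝ} (hq : q ∈ occupancySpace) : Antitone q :=
  antitone_nat_of_succ_le fun i => (hq.2 i).2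

theorem occupancySpace_le_one {q : ℕ → ℝ} (hq : q ∈ occupancySpace) (i : ℕ) : q i ≤ 1 :=
  hq.1 ▸ occupancySpace_antitone hq (Nat.zero_le i)

open Classical in
theorem sum_indicator_Ico {c : ℕ → ℝ} (hc : Monotone c) (x : ℝ) (a : ℕ) :
    ∑ k ∈ Finset.range a, (if x ∈ Set.Ico (c k) (c (k + 1)) then (1 : ℝ) else 0)
      = if x ∈ Set.Ico (c 0) (c a) then 1 else 0 := by
  induction a with
  | zero => simp
  | succ a ih =>
    rw [Finset.sum_range_succ, ih]
    have h0 : c 0 ≤ c a := hc (Nat.zero_le a)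
    have h1 : c a ≤ c (a + 1) := hc (Nat.le_succ a)
    simp only [Set.mem_Ico]
    split_ifs <;> grind

theorem routing_nonneg (q : ℕ → ℝ) (ell k : ℕ) (x : ℝ) : 0 ≤ routing q ell k x := by
  unfold routing
  split_ifs <;> norm_num

/-- Indicator that a task is sent to a server pool with fewer than `a` tasks. -/
noncomputable def routedBelow (q : ℕ → ℝ) (ell a : ℕ) (x : ℝ) : ℝ :=
  ∑ k ∈ Finset.range a, routing q ell k x

theorem routedBelow_nonneg (q : ℕ → ℝ) (ell a : ℕ) (x : ℝ) : 0 ≤ routedBelow q ell a x :=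
  Finset.sum_nonneg fun _ _ => routing_nonneg _ _ _ _

theorem routedBelow_le_succ (q : ℕ → ℝ) (ell a : ℕ) (x : ℝ) :
    routedBelow q ell a x ≤ routedBelow q ell (a + 1) x := by
  rw [routedBelow, routedBelow, Finset.sum_range_succ]
  exact le_add_of_nonneg_right (routing_nonneg _ _ _ _)

-- The selection intervals of consecutive levels abut, so their indicators telescope; levels from
-- `ell` on receive nothing, hence the minimum.
open Classical in
theorem routedBelow_of_lt_one {q : ℕ → ℝ} (hq : q ∈ occupancySpace) {ell : ℕ} (h : q ell < 1)
    (a : ℕ) (x : ℝ) :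
    routedBelow q ell a x =
      if x ∈ Set.Ico 0 ((1 - q (min a ell)) / (1 - q ell)) then 1 else 0 := by
  have hanti := occupancySpace_antitone hq
  have hpos : 0 < 1 - q ell := by linarith
  have hc : Monotone fun k => (1 - q k) / (1 - q ell) := by
    intro i j hij
    have := hanti hij
    dsimp only
    gcongr
  have hk : ∀ k, routing q ell k x = if k < ell then
      (if x ∈ Set.Ico ((1 - q k) / (1 - q ell)) ((1 - q (k + 1)) / (1 - q ell)) then (1 : ℝ) else 0)
      else 0 := by
    intro k
    have h2 : q (ell + 1) ≠ 1 := by have := (hq.2 ell).2; linarith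
    simp [routing, h, h.ne, h2]
  have key := sum_indicator_Ico hc x (min a ell)
  simp only [hq.1, sub_self, zero_div] at key
  rw [← key, routedBelow, Finset.sum_congr rfl fun k _ => hk k, ← Finset.sum_filter]
  congr 1
  ext k
  simp

theorem routedBelow_of_eq_one {q : ℕ → ℝ} {ell : ℕ} (h : q ell = 1) (h' : q (ell + 1) < 1)
    (a : ℕ) (x : ℝ) : routedBelow q ell a x = if ell < a then 1 else 0 := by
  have hk : ∀ k, routing q ell k x = if k = ell then (1 : ℝ) else 0 := by
    intro k
    by_cases hk : k = ell
    · subst hk; simp [routing, h, h']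
    · simp [routing, h, h'.ne, hk]
  rw [routedBelow, Finset.sum_congr rfl fun k _ => hk k, Finset.sum_ite_eq']
  simp

theorem routedBelow_le_one {q : ℕ → ℝ} (hq : q ∈ occupancySpace) (ell a : ℕ) (x : ℝ) :
    routedBelow q ell a x ≤ 1 := by
  classical
  rcases (occupancySpace_le_one hq ell).lt_or_eq with h | h
  · rw [routedBelow_of_lt_one hq h]
    split_ifs <;> norm_num
  · rcases (occupancySpace_le_one hq (ell + 1)).lt_or_eq with h' | h'
    · rw [routedBelow_of_eq_one h h']
      split_ifs <;> norm_num
    · have hanti := occupancySpace_antitone hq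
      have hc : Monotone fun k => 1 - q k := fun i j hij => by
        have := hanti hij
        dsimp only
        linarith
      calc routedBelow q ell a x
          ≤ ∑ k ∈ Finset.range a, (if x ∈ Set.Ico (1 - q k) (1 - q (k + 1)) then (1 : ℝ) else 0) := by
            refine Finset.sum_le_sum fun k _ => ?_
            unfold routing
            rw [h, h']
            split_ifs <;> simp_all
        _ = if x ∈ Set.Ico (1 - q 0) (1 - q a) then 1 else 0 := sum_indicator_Ico hc x a
        _ ≤ 1 := by split_ifs <;> norm_num

/-- Without overflow a task joins a pool with at most `ell` tasks, and with fewer than `ell` if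
there is one. Apart from order and bounds, this is all that the limit analysis retains of the
dispatching rule. -/
theorem routedBelow_eq_one {q : ℕ → ℝ} (hq : q ∈ occupancySpace) {ell a : ℕ} {x : ℝ}
    (hx : x ∈ Set.Ico (0 : ℝ) 1) (hover : q (ell + 1) ≠ 1)
    (h : ell < a ∨ (ell = a ∧ q a < 1)) : routedBelow q ell a x = 1 := by
  have hover' : q (ell + 1) < 1 := lt_of_le_of_ne (occupancySpace_le_one hq _) hover
  rcases (occupancySpace_le_one hq ell).lt_or_eq with h1 | h1
  · have hle : ell ≤ a := by omega
    rw [routedBelow_of_lt_one hq h1, min_eq_right hle, div_self (by linarith), if_pos hx]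
  · rw [routedBelow_of_eq_one h1 hover']
    rcases h with h | ⟨rfl, h⟩
    · simp [h]
    · linarith

/-! ### Truncated total mass and abstract dynamics -/

/-- The truncated total mass `∑_{1 ≤ i ≤ a} q i`. -/
noncomputable def mass (q : ℕ → ℝ) (a : ℕ) : ℝ := ∑ i ∈ Finset.range a, q (i + 1)

theorem mass_succ (q : ℕ → ℝ) (a : ℕ) : mass q (a + 1) = mass q a + q (a + 1) :=
  Finset.sum_range_succ _ _

/-- Summation by parts: this is the total departure rate, per pool, from pools with between `1` and
`a` tasks. -/
theorem sum_mul_sub_eq_mass (q : ℕ → ℝ) (a : ℕ) :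
    ∑ i ∈ Finset.range a, ((i + 1 : ℕ) : ℝ) * (q (i + 1) - q (i + 1 + 1)) =
      mass q a - a * q (a + 1) := by
  induction a with
  | zero => simp [mass]
  | succ a ih => rw [Finset.sum_range_succ, ih, mass_succ]; push_cast; ring

/-- The sample-path relations used in the asymptotic analysis. Here `A t` counts the arrivals up to
time `t`, task `j` (starting from `0`) finds occupancy `pre j` and threshold `L j`, it is sent to a
pool with fewer than `a` tasks if `S a j = 1`, and `dep a t` counts, divided by `n`, the departures
from pools with at most `a` tasks. -/
structure Dynamics (n : ℕ) (α : ℝ) (x : ℝ → ℕ → ℝ) (A : ℝ → ℕ) (L : ℕ → ℕ)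
    (pre : ℕ → ℕ → ℝ) (S : ℕ → ℕ → ℝ) (dep : ℕ → ℝ → ℝ) : Prop where
  mem : ∀ t, 0 ≤ t → x t ∈ occupancySpace
  pre_mem : ∀ j, pre j ∈ occupancySpace
  integrable : ∀ i t, 0 ≤ t → IntervalIntegrable (fun s => x s i) volume 0 t
  count_zero : A 0 = 0
  count_mono : Monotone A
  step : ∀ j, (L (j + 1) : ℤ) = L j + thresholdStep n α (pre j) (L j)
  pre_eq : ∀ a s t j, 0 ≤ s → A s ≤ j → j < A t →
    ∃ r, s ≤ r ∧ r < t ∧ A r = j ∧ ∀ i ≤ a, pre j i = x r i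
  mass_eq : ∀ a t, 0 ≤ t →
    mass (x t) a = mass (x 0) a + (1 / (n : ℝ)) * ∑ j ∈ Finset.range (A t), S a j - dep a t
  dep_nonneg : ∀ a t, 0 ≤ dep a t
  S_nonneg : ∀ a j, 0 ≤ S a j
  S_le_one : ∀ a j, S a j ≤ 1
  S_le_succ : ∀ a j, S a j ≤ S (a + 1) j
  S_eq_one : ∀ a j, pre j (L j + 1) ≠ 1 → (L j < a ∨ (L j = a ∧ pre j a < 1)) → S a j = 1

/-! ### The dynamics of a system path -/

theorem sum_Icc_one_eq_sum_range {M : Type*} [AddCommMonoid M] (f : ℕ → M) (n : ℕ) :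
    ∑ j ∈ Finset.Icc 1 n, f j = ∑ j ∈ Finset.range n, f (j + 1) := by
  induction n with
  | zero => simp
  | succ n ih => rw [Finset.sum_Icc_succ_top (by omega), ih, Finset.sum_range_succ]

/-- A bounded set of naturals contains its supremum, and a monotone function is constant once it has
attained it. -/
theorem eventually_const_left_of_monotoneOn {f : ℝ → ℕ} {b : ℝ} (hb : 0 < b)
    (hf : MonotoneOn f (Set.Icc 0 b)) : ∃ c, ∀ᶠ r in 𝓝[<] b, f r = c := by
  have hne : (f '' Set.Ico 0 b).Nonempty := ⟨f 0, 0, ⟨le_rfl, hb⟩, rfl⟩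
  have hbd : BddAbove (f '' Set.Ico 0 b) := by
    refine ⟨f b, ?_⟩
    rintro _ ⟨r, hr, rfl⟩
    exact hf ⟨hr.1, hr.2.le⟩ ⟨hb.le, le_rfl⟩ hr.2.le
  obtain ⟨r₀, hr₀, he⟩ := Nat.sSup_mem hne hbd
  refine ⟨f r₀, ?_⟩
  filter_upwards [Ioo_mem_nhdsLT hr₀.2] with r hr
  have h0 : 0 ≤ r := hr₀.1.trans hr.1.le
  refine le_antisymm ?_ (hf ⟨hr₀.1, hr₀.2.le⟩ ⟨h0, hr.2.le⟩ hr.1.le)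
  rw [he]
  exact le_csSup hbd ⟨r, ⟨h0, hr.2⟩, rfl⟩

/-! ### Arrival counts and arrival times -/

section Count

variable {n : ℕ} {N : ℝ≥0 → ℕ} {rate : ℝ}

theorem arrivalCount_mono (hN : IsCountingPath N rate) : Monotone (arrivalCount n N) := by
  intro s t hst
  refine hN.mono ?_
  have := Real.toNNReal_le_toNNReal hst
  gcongr

theorem arrivalCount_zero (hN : IsCountingPath N rate) : arrivalCount n N 0 = 0 := by
  simp [arrivalCount, hN.zero]

theorem exists_arrivalCount_eq (hN : IsCountingPath N rate) (hn : 1 ≤ n) (j : ℕ) :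
    ∃ t, 0 ≤ t ∧ arrivalCount n N t = j := by
  obtain ⟨s, hs⟩ := hN.surjective j
  refine ⟨(s / n : ℝ≥0), by positivity, ?_⟩
  have : (n : ℝ≥0) ≠ 0 := by exact_mod_cast (by omega : n ≠ 0)
  rw [arrivalCount, Real.toNNReal_coe, mul_div_cancel₀ _ this, hs]

theorem arrivalTime_nonneg (j : ℕ) : 0 ≤ arrivalTime n N j :=
  Real.sInf_nonneg fun _ ht => ht.1

/-- The infimum is attained, because a right-continuous integer-valued path is constant on a short
interval to the right of each time. -/
theorem le_arrivalCount_arrivalTime (hN : IsCountingPath N rate) (hn : 1 ≤ n) (j : ℕ) :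
    j ≤ arrivalCount n N (arrivalTime n N j) := by
  set σ := arrivalTime n N j with hσ
  have hσ0 : 0 ≤ σ := arrivalTime_nonneg j
  obtain ⟨t₀, ht₀, htj⟩ := exists_arrivalCount_eq hN hn j
  have hne : {t : ℝ | 0 ≤ t ∧ j ≤ arrivalCount n N t}.Nonempty := ⟨t₀, ht₀, htj.ge⟩
  have hcont := hN.rightContinuous (n * σ.toNNReal)
  have hev : ∀ᶠ u in 𝓝[≥] ((n : ℝ≥0) * σ.toNNReal), N u = N (n * σ.toNNReal) := by
    have := hcont.eventually (show ∀ᶠ v in 𝓝 (N (n * σ.toNNReal)), v = N (n * σ.toNNReal) by simp)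
    exact this
  have hev' : ∀ᶠ t in 𝓝[≥] σ, arrivalCount n N t = arrivalCount n N σ := by
    have hmap : Tendsto (fun t : ℝ => (n : ℝ≥0) * t.toNNReal) (𝓝[≥] σ)
        (𝓝[≥] ((n : ℝ≥0) * σ.toNNReal)) := by
      refine tendsto_nhdsWithin_iff.2 ⟨?_, ?_⟩
      · have : Continuous fun t : ℝ => (n : ℝ≥0) * t.toNNReal := by fun_prop
        exact this.continuousWithinAt
      · filter_upwards [self_mem_nhdsWithin] with t ht
        have := Real.toNNReal_le_toNNReal (Set.mem_Ici.1 ht)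
        exact Set.mem_Ici.2 (by gcongr)
    exact hmap.eventually hev
  rw [eventually_nhdsWithin_iff, Metric.eventually_nhds_iff] at hev'
  obtain ⟨δ, hδ, hev'⟩ := hev'
  obtain ⟨t, ht, htδ⟩ := exists_lt_of_csInf_lt hne (show sInf _ < σ + δ by
    change σ < σ + δ; linarith)
  have hσt : σ ≤ t := csInf_le ⟨0, fun _ h => h.1⟩ ht
  rw [← hev' (by rw [Real.dist_eq, abs_of_nonneg (by linarith)]; linarith) hσt]
  exact ht.2

theorem arrivalTime_le {j : ℕ} {t : ℝ} (ht : 0 ≤ t) (h : j ≤ arrivalCount n N t) :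
    arrivalTime n N j ≤ t := csInf_le ⟨0, fun _ h => h.1⟩ ⟨ht, h⟩

theorem lt_arrivalTime (hN : IsCountingPath N rate) (hn : 1 ≤ n) {j : ℕ} {t : ℝ}
    (h : arrivalCount n N t < j) : t < arrivalTime n N j := by
  by_contra hle
  exact absurd ((le_arrivalCount_arrivalTime hN hn j).trans (arrivalCount_mono hN (not_lt.1 hle)))
    (by omega)

theorem arrivalCount_lt_of_lt (hN : IsCountingPath N rate) {j : ℕ} {t : ℝ}
    (h : t < arrivalTime n N j) (hj : 1 ≤ j) : arrivalCount n N t < j := by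
  by_contra hle
  rcases le_or_gt 0 t with ht | ht
  · exact absurd (arrivalTime_le ht (not_lt.1 hle)) (not_le.2 h)
  · have := arrivalCount_mono (n := n) hN ht.le
    rw [arrivalCount_zero hN] at this
    omega

/-- Here unit jumps matter: the count `j` is attained at some time, which must precede arrival `j +
1`. -/
theorem eventually_arrivalCount_eq (hN : IsCountingPath N rate) (hn : 1 ≤ n) (j : ℕ) :
    ∀ᶠ r in 𝓝[<] (arrivalTime n N (j + 1)), arrivalCount n N r = j := by
  obtain ⟨t, -, ht⟩ := exists_arrivalCount_eq hN hn j
  have h1 : t < arrivalTime n N (j + 1) := lt_arrivalTime hN hn (by omega)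
  filter_upwards [Ioo_mem_nhdsLT h1] with r hr
  have h2 := arrivalCount_mono (n := n) hN hr.1.le
  have h3 := arrivalCount_lt_of_lt hN hr.2 (by omega)
  omega

end Count

/-! ### From a system path to the abstract relations -/

section Path

variable {n : ℕ} {α lam : ℝ} {N : ℝ≥0 → ℕ} {D : ℕ → ℝ≥0 → ℕ} {U : ℕ → ℝ}
  {q : ℝ → ℕ → ℝ} {ell : ℝ → ℕ}

/-- The cumulative departure rate from pools with exactly `i` tasks. -/
noncomputable def cumulativeRate (q : ℝ → ℕ → ℝ) (i : ℕ) (t : ℝ) : ℝ :=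
  ∫ s in (0 : ℝ)..t, (i : ℝ) * (q s i - q s (i + 1))

theorem arrivalTerm_succ (n : ℕ) (N : ℝ≥0 → ℕ) (U : ℕ → ℝ) (q : ℝ → ℕ → ℝ) (ell : ℝ → ℕ)
    (t : ℝ) (k : ℕ) :
    arrivalTerm n N U q ell t (k + 1) = (1 / (n : ℝ)) * ∑ j ∈ Finset.range (arrivalCount n N t),
      routing (occupancyBefore q (arrivalTime n N (j + 1)))
        (thresholdBefore ell (arrivalTime n N (j + 1))) k (U (j + 1)) := by
  rw [arrivalTerm, sum_Icc_one_eq_sum_range]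

theorem arrivalTerm_mono (hN : IsCountingPath N lam) (i : ℕ) :
    Monotone fun t => arrivalTerm n N U q ell t i := by
  intro s t hst
  cases i with
  | zero => exact le_rfl
  | succ k =>
    simp only [arrivalTerm_succ]
    refine mul_le_mul_of_nonneg_left ?_ (by positivity)
    exact Finset.sum_le_sum_of_subset_of_nonneg
      (Finset.range_subset_range.2 (arrivalCount_mono hN hst)) fun _ _ _ => routing_nonneg _ _ _ _

theorem IsSystemPath.rate_nonneg (h : IsSystemPath n α N D U q ell) (i : ℕ) {s : ℝ} (hs : 0 ≤ s) :
    0 ≤ (i : ℝ) * (q s i - q s (i + 1)) :=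
  mul_nonneg (by positivity) (by linarith [((h.mem_occupancySpace s hs).2 i).2])

/-- Measurability of the occupancy in time has to be extracted from its own equation. The times up
to which the rate is integrable form an interval, on which the cumulative departures are monotone.
-/
theorem IsSystemPath.aemeasurable_departureTerm (h : IsSystemPath n α N D U q ell)
    (hD : ∀ i, IsCountingPath (D i) 1) (i : ℕ) :
    AEMeasurable (fun t => departureTerm n D q t i) (volume.restrict (Set.Ici 0)) := by
  by_cases hi : i = 0
  · simp [departureTerm, hi]
  set B : Set ℝ := {t | 0 ≤ t ∧
    IntervalIntegrable (fun s => (i : ℝ) * (q s i - q s (i + 1))) volume 0 t} with hB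
  have hord : B.OrdConnected := by
    refine ⟨fun s hs t ht u hu => ⟨hs.1.trans hu.1, ht.2.mono_set ?_⟩⟩
    rw [Set.uIcc_of_le (hs.1.trans hu.1), Set.uIcc_of_le ht.1]
    exact Set.Icc_subset_Icc_right hu.2
  have hBm : MeasurableSet B := hord.measurableSet
  have hsplit : Set.Ici (0 : ℝ) = B ∪ (Set.Ici 0 \ B) := by
    ext t; simp only [hB, Set.mem_Ici, Set.mem_union, Set.mem_sdiff]; grind
  rw [hsplit, aemeasurable_union_iff]
  constructor
  · refine aemeasurable_restrict_of_monotoneOn hBm ?_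
    intro s hs t ht hst
    simp only [departureTerm, if_neg hi]
    refine mul_le_mul_of_nonneg_left ?_ (by positivity)
    refine Nat.cast_le.2 ((hD i).mono (Real.toNNReal_le_toNNReal ?_))
    refine mul_le_mul_of_nonneg_left ?_ (by positivity)
    refine intervalIntegral.integral_mono_interval le_rfl hs.1 hst ?_ ht.2
    refine (ae_restrict_iff' measurableSet_Ioc).2 (ae_of_all _ fun u hu => ?_)
    exact h.rate_nonneg i hu.1.le
  -- Beyond that interval the integral takes its default value zero, so the departure term is
  -- constant.
  · refine AEMeasurable.congr (f := fun _ => (1 / (n : ℝ)) * (D i 0 : ℝ)) (by fun_prop) ?_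
    refine (ae_restrict_iff' (measurableSet_Ici.diff hBm)).2 (ae_of_all _ fun t ht => ?_)
    have : ¬ IntervalIntegrable (fun s => (i : ℝ) * (q s i - q s (i + 1))) volume 0 t :=
      fun hint => ht.2 ⟨ht.1, hint⟩
    simp only [departureTerm, if_neg hi, intervalIntegral.integral_undef this]
    simp

theorem IsSystemPath.intervalIntegrable (h : IsSystemPath n α N D U q ell)
    (hN : IsCountingPath N lam) (hD : ∀ i, IsCountingPath (D i) 1) (i : ℕ) {t : ℝ} (ht : 0 ≤ t) :
    IntervalIntegrable (fun s => q s i) volume 0 t := by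
  have hm : AEMeasurable (fun s => q s i) (volume.restrict (Set.Ici 0)) := by
    have h1 : AEMeasurable (fun s => arrivalTerm n N U q ell s i) (volume.restrict (Set.Ici 0)) :=
      (arrivalTerm_mono hN i).measurable.aemeasurable
    refine ((h1.const_add (q 0 i)).sub (h.aemeasurable_departureTerm hD i)).congr ?_
    refine (ae_restrict_iff' measurableSet_Ici).2 (ae_of_all _ fun s hs => ?_)
    exact (h.occupancy_eq s hs i).symm
  rw [intervalIntegrable_iff_integrableOn_Ioc_of_le ht]
  have hsub : Set.Ioc 0 t ⊆ Set.Ici 0 := fun s hs => hs.1.le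
  refine Integrable.of_bound
    (hm.mono_measure (Measure.restrict_mono hsub le_rfl)).aestronglyMeasurable 1 ?_
  refine (ae_restrict_iff' measurableSet_Ioc).2 (ae_of_all _ fun s hs => ?_)
  have hq := h.mem_occupancySpace s hs.1.le
  rw [Real.norm_eq_abs, abs_of_nonneg (hq.2 i).1]
  exact occupancySpace_le_one hq i

theorem IsSystemPath.intervalIntegrable_rate (h : IsSystemPath n α N D U q ell)
    (hN : IsCountingPath N lam) (hD : ∀ i, IsCountingPath (D i) 1) (i : ℕ) {t : ℝ} (ht : 0 ≤ t) :
    IntervalIntegrable (fun s => (i : ℝ) * (q s i - q s (i + 1))) volume 0 t :=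
  ((h.intervalIntegrable hN hD i ht).sub (h.intervalIntegrable hN hD (i + 1) ht)).const_mul _

theorem IsSystemPath.cumulativeRate_monotoneOn (h : IsSystemPath n α N D U q ell)
    (hN : IsCountingPath N lam) (hD : ∀ i, IsCountingPath (D i) 1) (i : ℕ) :
    MonotoneOn (cumulativeRate q i) (Set.Ici 0) := by
  intro s hs t ht hst
  refine intervalIntegral.integral_mono_interval le_rfl hs hst ?_
    (h.intervalIntegrable_rate hN hD i ht)
  refine (ae_restrict_iff' measurableSet_Ioc).2 (ae_of_all _ fun u hu => ?_)
  exact h.rate_nonneg i hu.1.le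

theorem IsSystemPath.cumulativeRate_mem (h : IsSystemPath n α N D U q ell)
    (hN : IsCountingPath N lam) (hD : ∀ i, IsCountingPath (D i) 1) (i : ℕ) {t : ℝ} (ht : 0 ≤ t) :
    cumulativeRate q i t ∈ Set.Icc 0 (i * t) := by
  constructor
  · exact intervalIntegral.integral_nonneg ht fun s hs => h.rate_nonneg i hs.1
  · have h1 : cumulativeRate q i t ≤ ∫ _ in (0 : ℝ)..t, (i : ℝ) := by
      refine intervalIntegral.integral_mono_on ht (h.intervalIntegrable_rate hN hD i ht)
        (by simp) fun s hs => ?_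
      have hq := h.mem_occupancySpace s hs.1
      have h2 := occupancySpace_le_one hq i
      have h3 := (hq.2 (i + 1)).1
      have h4 : (0 : ℝ) ≤ i := by positivity
      nlinarith
    simpa [mul_comm] using h1

/-- Arrivals and departures are monotone integer counts, so both are frozen just before an arrival
and the left limit is an attained value. -/
theorem IsSystemPath.eventually_eq_occupancyBefore (h : IsSystemPath n α N D U q ell)
    (hN : IsCountingPath N lam) (hD : ∀ i, IsCountingPath (D i) 1) (hn : 1 ≤ n) (j i : ℕ) :
    ∀ᶠ r in 𝓝[<] (arrivalTime n N (j + 1)),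
      q r i = occupancyBefore q (arrivalTime n N (j + 1)) i := by
  have hσ : 0 < arrivalTime n N (j + 1) :=
    lt_arrivalTime hN hn (by rw [arrivalCount_zero hN]; omega)
  set σ := arrivalTime n N (j + 1) with hσdef
  have hmono : MonotoneOn (fun t => D i (Real.toNNReal (n * cumulativeRate q i t)))
      (Set.Icc 0 σ) := by
    intro s hs t ht hst
    refine (hD i).mono (Real.toNNReal_le_toNNReal ?_)
    exact mul_le_mul_of_nonneg_left
      (h.cumulativeRate_monotoneOn hN hD i hs.1 ht.1 hst) (by positivity)
  obtain ⟨c, hc⟩ := eventually_const_left_of_monotoneOn hσ hmono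
  have hev := (hc.and (eventually_arrivalCount_eq hN hn j)).and (Ioo_mem_nhdsLT hσ)
  have hconst : ∃ v, ∀ᶠ r in 𝓝[<] σ, q r i = v := by
    obtain ⟨r₀, ⟨h1, h2⟩, h3⟩ := hev.exists
    refine ⟨q r₀ i, ?_⟩
    filter_upwards [hev] with r hr
    have harr : arrivalTerm n N U q ell r i = arrivalTerm n N U q ell r₀ i := by
      cases i with
      | zero => rfl
      | succ k => rw [arrivalTerm_succ, arrivalTerm_succ, hr.1.2, h2]
    have hdep : departureTerm n D q r i = departureTerm n D q r₀ i := by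
      change (if i = 0 then 0 else (1 / (n : ℝ)) *
          (D i (Real.toNNReal (n * cumulativeRate q i r)) : ℝ)) =
        if i = 0 then 0 else (1 / (n : ℝ)) * (D i (Real.toNNReal (n * cumulativeRate q i r₀)) : ℝ)
      rw [hr.1.1, h1]
    rw [h.occupancy_eq r hr.2.1.le i, h.occupancy_eq r₀ h3.1.le i, harr, hdep]
  obtain ⟨v, hv⟩ := hconst
  have hlim : occupancyBefore q σ i = v := by
    refine leftLim_eq_of_tendsto (Tendsto.congr' ?_ tendsto_const_nhds)
    filter_upwards [hv] with r hr using hr.symm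
  rw [hlim]
  exact hv

/-- The threshold after `j` arrivals. -/
noncomputable def thresholdAfter (n : ℕ) (α : ℝ) (N : ℝ≥0 → ℕ) (q : ℝ → ℕ → ℝ) (ell : ℝ → ℕ)
    (j : ℕ) : ℕ :=
  ((ell 0 : ℤ) + ∑ i ∈ Finset.range j,
    thresholdStep n α (occupancyBefore q (arrivalTime n N (i + 1)))
        (thresholdBefore ell (arrivalTime n N (i + 1)))).toNat

theorem IsSystemPath.threshold_eq_thresholdAfter (h : IsSystemPath n α N D U q ell) {t : ℝ}
    (ht : 0 ≤ t) : ell t = thresholdAfter n α N q ell (arrivalCount n N t) := by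
  have := h.threshold_eq t ht
  rw [sum_Icc_one_eq_sum_range] at this
  rw [thresholdAfter, ← this, Int.toNat_natCast]

/-- Every `j` is the arrival count at some time, when the integer sum equals an actual threshold;
hence `toNat` truncates nothing. -/
theorem IsSystemPath.coe_thresholdAfter (h : IsSystemPath n α N D U q ell)
    (hN : IsCountingPath N lam) (hn : 1 ≤ n) (j : ℕ) :
    (thresholdAfter n α N q ell j : ℤ) = (ell 0 : ℤ) + ∑ i ∈ Finset.range j,
      thresholdStep n α (occupancyBefore q (arrivalTime n N (i + 1)))
        (thresholdBefore ell (arrivalTime n N (i + 1))) := by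
  obtain ⟨t, ht, htj⟩ := exists_arrivalCount_eq hN hn j
  have h1 := h.threshold_eq t ht
  rw [h.threshold_eq_thresholdAfter ht, htj, sum_Icc_one_eq_sum_range] at h1
  exact h1

theorem IsSystemPath.thresholdBefore_eq (h : IsSystemPath n α N D U q ell)
    (hN : IsCountingPath N lam) (hn : 1 ≤ n) (j : ℕ) :
    thresholdBefore ell (arrivalTime n N (j + 1)) = thresholdAfter n α N q ell j := by
  have hσ : 0 < arrivalTime n N (j + 1) :=
    lt_arrivalTime hN hn (by rw [arrivalCount_zero hN]; omega)
  refine leftLim_eq_of_tendsto (Tendsto.congr' ?_ tendsto_const_nhds)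
  filter_upwards [eventually_arrivalCount_eq hN hn j, Ioo_mem_nhdsLT hσ] with r h1 h2
  rw [h.threshold_eq_thresholdAfter h2.1.le, h1]

theorem IsSystemPath.occupancyBefore_mem (h : IsSystemPath n α N D U q ell)
    (hN : IsCountingPath N lam) (hD : ∀ i, IsCountingPath (D i) 1) (hn : 1 ≤ n) (j : ℕ) :
    occupancyBefore q (arrivalTime n N (j + 1)) ∈ occupancySpace := by
  have hσ : 0 < arrivalTime n N (j + 1) :=
    lt_arrivalTime hN hn (by rw [arrivalCount_zero hN]; omega)
  have key := fun i => h.eventually_eq_occupancyBefore hN hD hn j i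
  constructor
  · obtain ⟨r, h1, h2⟩ := ((key 0).and (Ioo_mem_nhdsLT hσ)).exists
    rw [← h1]
    exact (h.mem_occupancySpace r h2.1.le).1
  · intro i
    obtain ⟨r, ⟨h1, h1'⟩, h2⟩ := (((key i).and (key (i + 1))).and (Ioo_mem_nhdsLT hσ)).exists
    rw [← h1, ← h1']
    exact (h.mem_occupancySpace r h2.1.le).2 i

/-- The cumulative departures from pools with at most `a` tasks, divided by `n`. -/
noncomputable def departuresBelow (n : ℕ) (D : ℕ → ℝ≥0 → ℕ) (q : ℝ → ℕ → ℝ) (a : ℕ) (t : ℝ) : ℝ :=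
  ∑ i ∈ Finset.range a, departureTerm n D q t (i + 1)

theorem IsSystemPath.dynamics (h : IsSystemPath n α N D U q ell)
    (hN : IsCountingPath N lam) (hD : ∀ i, IsCountingPath (D i) 1) (hn : 1 ≤ n)
    (hU : ∀ j, U j ∈ Set.Ico (0 : ℝ) 1) :
    Dynamics n α q (arrivalCount n N) (thresholdAfter n α N q ell)
      (fun j => occupancyBefore q (arrivalTime n N (j + 1)))
      (fun a j => routedBelow (occupancyBefore q (arrivalTime n N (j + 1)))
        (thresholdAfter n α N q ell j) a (U (j + 1)))
      (departuresBelow n D q) where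
  mem := h.mem_occupancySpace
  pre_mem := h.occupancyBefore_mem hN hD hn
  integrable := fun i t ht => h.intervalIntegrable hN hD i ht
  count_zero := arrivalCount_zero hN
  count_mono := arrivalCount_mono hN
  step := by
    intro j
    rw [h.coe_thresholdAfter hN hn, h.coe_thresholdAfter hN hn, Finset.sum_range_succ,
      h.thresholdBefore_eq hN hn]
    ring
  pre_eq := by
    intro a s t j hs hsj hjt
    have h1 : s < arrivalTime n N (j + 1) := lt_arrivalTime hN hn (by omega)
    have ht : 0 ≤ t := by
      by_contra hlt
      have := arrivalCount_mono (n := n) hN (not_le.1 hlt).le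
      rw [arrivalCount_zero hN] at this
      omega
    have h2 : arrivalTime n N (j + 1) ≤ t := arrivalTime_le ht hjt
    -- Left limits are attained level by level, so one common time is available only for finitely
    -- many levels.
    have hall : ∀ᶠ r in 𝓝[<] (arrivalTime n N (j + 1)), ∀ i ∈ Finset.range (a + 1),
        q r i = occupancyBefore q (arrivalTime n N (j + 1)) i :=
      (Finset.range (a + 1)).eventually_all.2 fun i _ =>
        h.eventually_eq_occupancyBefore hN hD hn j i
    obtain ⟨r, ⟨hr1, hr2⟩, hr3⟩ :=
      ((hall.and (eventually_arrivalCount_eq hN hn j)).and (Ioo_mem_nhdsLT h1)).exists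
    exact ⟨r, hr3.1.le, hr3.2.trans_le h2, hr2, fun i hi => (hr1 i (by simp; omega)).symm⟩
  mass_eq := by
    intro a t ht
    simp only [mass, departuresBelow, routedBelow]
    rw [Finset.sum_comm, Finset.mul_sum, ← Finset.sum_add_distrib, ← Finset.sum_sub_distrib]
    refine Finset.sum_congr rfl fun i _ => ?_
    rw [h.occupancy_eq t ht, arrivalTerm_succ]
    simp only [h.thresholdBefore_eq hN hn]
  dep_nonneg := by
    intro a t
    refine Finset.sum_nonneg fun i _ => ?_
    rw [departureTerm, if_neg (by omega)]
    positivity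
  S_nonneg := fun _ _ => routedBelow_nonneg _ _ _ _
  S_le_one := fun _ j => routedBelow_le_one (h.occupancyBefore_mem hN hD hn j) _ _ _
  S_le_succ := fun _ _ => routedBelow_le_succ _ _ _ _
  S_eq_one := fun _ j hover hl =>
    routedBelow_eq_one (h.occupancyBefore_mem hN hD hn j) (hU _) hover hl

/-- The cumulative rate of level `i` is at most `i * T`, so the law of large numbers for `D i`
applies at the random times; the `a` errors add up. -/
theorem IsSystemPath.abs_departuresBelow_sub_le (h : IsSystemPath n α N D U q ell)
    (hN : IsCountingPath N lam) (hD : ∀ i, IsCountingPath (D i) 1) (hn : 1 ≤ n) {a : ℕ} {T ε : ℝ}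
    (hε : ∀ i < a, ∀ s : ℝ≥0, (s : ℝ) ≤ n * (((i + 1 : ℕ) : ℝ) * T) →
      |(D (i + 1) s : ℝ) - 1 * s| ≤ ε * n) {t : ℝ} (ht : t ∈ Set.Icc 0 T) :
    |departuresBelow n D q a t - ∫ s in (0 : ℝ)..t, (mass (q s) a - a * q s (a + 1))| ≤ a * ε := by
  have hn' : (0 : ℝ) < n := by exact_mod_cast hn
  have hint : ∫ s in (0 : ℝ)..t, (mass (q s) a - a * q s (a + 1)) =
      ∑ i ∈ Finset.range a, cumulativeRate q (i + 1) t := by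
    simp only [cumulativeRate]
    rw [← intervalIntegral.integral_finsetSum
      fun i _ => h.intervalIntegrable_rate hN hD (i + 1) ht.1]
    exact intervalIntegral.integral_congr fun s _ => (sum_mul_sub_eq_mass (q s) a).symm
  rw [hint, departuresBelow, ← Finset.sum_sub_distrib]
  refine (Finset.abs_sum_le_sum_abs _ _).trans ?_
  calc ∑ i ∈ Finset.range a, |departureTerm n D q t (i + 1) - cumulativeRate q (i + 1) t|
      ≤ ∑ _i ∈ Finset.range a, ε := by
        refine Finset.sum_le_sum fun i hi => ?_
        have hmem := h.cumulativeRate_mem hN hD (i + 1) ht.1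
        have hnn : 0 ≤ n * cumulativeRate q (i + 1) t := mul_nonneg hn'.le hmem.1
        have h1 := hε i (Finset.mem_range.1 hi) (Real.toNNReal (n * cumulativeRate q (i + 1) t)) (by
          rw [Real.coe_toNNReal _ hnn]
          refine mul_le_mul_of_nonneg_left (hmem.2.trans ?_) hn'.le
          exact mul_le_mul_of_nonneg_left ht.2 (by positivity))
        rw [Real.coe_toNNReal _ hnn, one_mul] at h1
        have h2 : departureTerm n D q t (i + 1) - cumulativeRate q (i + 1) t =
            (1 / (n : ℝ)) * ((D (i + 1) (Real.toNNReal (n * cumulativeRate q (i + 1) t)) : ℝ) -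
              n * cumulativeRate q (i + 1) t) := by
          rw [departureTerm, if_neg (by omega)]
          change 1 / (n : ℝ) * (D (i + 1) (Real.toNNReal (n * cumulativeRate q (i + 1) t)) : ℝ) - _
            = _
          field_simp
        rw [h2, abs_mul, abs_of_pos (by positivity), one_div, inv_mul_le_iff₀ hn']
        linarith
    _ = a * ε := by simp

end Path

/-! ### Elementary facts about truncated masses and threshold steps -/

theorem mass_nonneg {q : ℕ → ℝ} (hq : q ∈ occupancySpace) (a : ℕ) : 0 ≤ mass q a :=
  Finset.sum_nonneg fun i _ => (hq.2 (i + 1)).1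

theorem mass_le {q : ℕ → ℝ} (hq : q ∈ occupancySpace) (a : ℕ) : mass q a ≤ a := by
  calc mass q a ≤ ∑ _i ∈ Finset.range a, (1 : ℝ) :=
        Finset.sum_le_sum fun i _ => occupancySpace_le_one hq _
    _ = a := by simp

theorem mul_le_mass {q : ℕ → ℝ} (hq : q ∈ occupancySpace) (a : ℕ) : a * q a ≤ mass q a := by
  calc a * q a = ∑ _i ∈ Finset.range a, q a := by simp
    _ ≤ mass q a := Finset.sum_le_sum fun i hi =>
        occupancySpace_antitone hq (by have := Finset.mem_range.1 hi; omega)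

theorem mul_succ_le_mass {q : ℕ → ℝ} (hq : q ∈ occupancySpace) (a : ℕ) :
    a * q (a + 1) ≤ mass q a :=
  (mul_le_mul_of_nonneg_left (hq.2 a).2 (by positivity)).trans (mul_le_mass hq a)

theorem mass_mono {q : ℕ → ℝ} (hq : q ∈ occupancySpace) : Monotone (mass q) :=
  monotone_nat_of_le_succ fun a => by rw [mass_succ]; linarith [(hq.2 (a + 1)).1]

/-- All summands are at most one, so the deficit of one level is at most the total deficit. -/
theorem one_sub_le_of_mass_ge {q : ℕ → ℝ} (hq : q ∈ occupancySpace) {a i : ℕ} {ε : ℝ}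
    (h : (a : ℝ) - ε ≤ mass q a) (hi : i ≤ a) : 1 - ε ≤ q i := by
  rcases Nat.eq_zero_or_pos i with rfl | hpos
  · have := mass_le hq a
    rw [hq.1]
    linarith
  · obtain ⟨k, rfl⟩ : ∃ k, i = k + 1 := ⟨i - 1, by omega⟩
    have h1 : mass q a ≤ ∑ j ∈ Finset.range a, (if j = k then q (k + 1) else 1) := by
      refine Finset.sum_le_sum fun j _ => ?_
      split_ifs with hj
      · rw [hj]
      · exact occupancySpace_le_one hq _
    have h2 : ∑ j ∈ Finset.range a, (if j = k then q (k + 1) else (1 : ℝ)) =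
        q (k + 1) - 1 + a := by
      have h3 : ∀ j, (if j = k then q (k + 1) else (1 : ℝ)) =
          (if j = k then q (k + 1) - 1 else 0) + 1 := by
        intro j; split_ifs <;> ring
      rw [Finset.sum_congr rfl fun j _ => h3 j, Finset.sum_add_distrib, Finset.sum_ite_eq']
      simp [Nat.lt_of_succ_le hi]
    linarith

theorem thresholdStep_le_one (n : ℕ) (α : ℝ) (q : ℕ → ℝ) (l : ℕ) : thresholdStep n α q l ≤ 1 := by
  unfold thresholdStep; split_ifs <;> norm_num

theorem neg_one_le_thresholdStep (n : ℕ) (α : ℝ) (q : ℕ → ℝ) (l : ℕ) :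
    -1 ≤ thresholdStep n α q l := by
  unfold thresholdStep; split_ifs <;> norm_num

theorem le_of_thresholdStep_pos {n : ℕ} {α : ℝ} {q : ℕ → ℝ} {l : ℕ}
    (h : 0 < thresholdStep n α q l) : 1 - 1 / (n : ℝ) ≤ q (l + 1) := by
  unfold thresholdStep at h; split_ifs at h <;> first | assumption | norm_num at h

theorem le_of_thresholdStep_neg {n : ℕ} {α : ℝ} {q : ℕ → ℝ} {l : ℕ}
    (h : thresholdStep n α q l < 0) : q l ≤ α := by
  unfold thresholdStep at h; split_ifs at h <;> first | assumption | norm_num at h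

theorem thresholdStep_eq_one {n : ℕ} {α : ℝ} {q : ℕ → ℝ} {l : ℕ} (h1 : α < q l)
    (h2 : 1 - 1 / (n : ℝ) ≤ q (l + 1)) : thresholdStep n α q l = 1 := by
  simp only [thresholdStep, if_pos h2, if_neg (not_le.2 h1), sub_zero]

theorem thresholdStep_eq_neg_one {n : ℕ} {α : ℝ} {q : ℕ → ℝ} {l : ℕ} (h1 : q l ≤ α)
    (h2 : q (l + 1) < 1 - 1 / (n : ℝ)) : thresholdStep n α q l = -1 := by
  simp only [thresholdStep, if_neg (not_le.2 h2), if_pos h1, zero_sub]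

/-! ### A walk that crosses no edge in both directions -/

theorem exists_down_crossing {L : ℕ → ℕ} (hdown : ∀ j, L j ≤ L (j + 1) + 1) {e p r : ℕ}
    (hpr : p ≤ r) (hp : e + 1 ≤ L p) (hr : L r ≤ e) :
    ∃ k, p ≤ k ∧ k < r ∧ L k = e + 1 ∧ L (k + 1) = e := by
  induction r, hpr using Nat.le_induction with
  | base => omega
  | succ r hpr ih =>
    by_cases h : L r ≤ e
    · obtain ⟨k, h1, h2, h3⟩ := ih h
      exact ⟨k, h1, by omega, h3⟩
    · have := hdown r
      exact ⟨r, hpr, by omega, by omega, by omega⟩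

/-- Between two up-steps from the same level the walk must step down across that edge. If this is
excluded, up-steps are determined by their starting levels, which are below `K`. -/
theorem card_up_steps_le {L : ℕ → ℕ} (hdown : ∀ j, L j ≤ L (j + 1) + 1) {p r K : ℕ}
    (hK : ∀ j, p ≤ j → j < r → L (j + 1) ≤ K)
    (hcross : ∀ i j, p ≤ i → i < r → p ≤ j → j < r → L (i + 1) = L i + 1 → L j = L i + 1 →
      L (j + 1) ≠ L i) :
    ((Finset.Ico p r).filter fun j => L (j + 1) = L j + 1).card ≤ K := by
  have hinj : Set.InjOn L ((Finset.Ico p r).filter fun j => L (j + 1) = L j + 1) := by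
    have key : ∀ i j, p ≤ i → i < j → j < r → L (i + 1) = L i + 1 → L i ≠ L j := by
      intro i j hi hij hj hup he
      obtain ⟨k, h1, h2, h3, h4⟩ :=
        exists_down_crossing (e := L i) (p := i + 1) (r := j) hdown hij hup.ge he.ge
      exact hcross i k hi (by omega) (by omega) (by omega) hup h3 h4
    intro i hi j hj he
    simp only [Finset.coe_filter, Finset.mem_Ico, Set.mem_ofPred_eq] at hi hj
    rcases lt_trichotomy i j with h | h | h
    · exact absurd he (key i j hi.1.1 h hj.1.2 hi.2)
    · exact h
    · exact absurd he.symm (key j i hj.1.1 h hi.1.2 hj.2)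
  calc _ = (((Finset.Ico p r).filter fun j => L (j + 1) = L j + 1).image L).card :=
        (Finset.card_image_of_injOn hinj).symm
    _ ≤ (Finset.range K).card := by
        refine Finset.card_le_card ?_
        intro v hv
        simp only [Finset.mem_image, Finset.mem_filter, Finset.mem_Ico] at hv
        obtain ⟨j, ⟨⟨h1, h2⟩, h3⟩, rfl⟩ := hv
        have := hK j h1 h2
        exact Finset.mem_range.2 (by omega)
    _ = K := Finset.card_range K

/-! ### A fluid-scaled sequence of systems -/

/-- A sequence of sample paths satisfying the dynamics, whose primitives obey the functional law of
large numbers and whose initial conditions converge. -/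
structure FluidSequence (α lam : ℝ) (x : ℕ → ℝ → ℕ → ℝ) (A : ℕ → ℝ → ℕ) (L : ℕ → ℕ → ℕ)
    (pre : ℕ → ℕ → ℕ → ℝ) (S : ℕ → ℕ → ℕ → ℝ) (dep : ℕ → ℕ → ℝ → ℝ) (q : ℕ → ℝ) (l : ℕ) :
    Prop where
  dynamics : ∀ n, 1 ≤ n → Dynamics n α (x n) (A n) (L n) (pre n) (S n) (dep n)
  arrivals : ∀ T ε : ℝ, 0 < ε → ∀ᶠ n : ℕ in atTop, ∀ t ∈ Set.Icc 0 T,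
    |(1 / (n : ℝ)) * (A n t : ℝ) - lam * t| ≤ ε
  departures : ∀ (a : ℕ) (T ε : ℝ), 0 < ε → ∀ᶠ n : ℕ in atTop, ∀ t ∈ Set.Icc 0 T,
    |dep n a t - ∫ s in (0 : ℝ)..t, (mass (x n s) a - a * x n s (a + 1))| ≤ ε
  init : ∀ i, Tendsto (fun n => x n 0 i) atTop (𝓝 (q i))
  init_threshold : ∀ᶠ n in atTop, L n 0 = l
  mem : q ∈ occupancySpace
  summable : Summable q
  alpha_lt_one : α < 1
  lam_pos : 0 < lam

section Fluid

variable {α lam : ℝ} {x : ℕ → ℝ → ℕ → ℝ} {A : ℕ → ℝ → ℕ} {L : ℕ → ℕ → ℕ}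
  {pre : ℕ → ℕ → ℕ → ℝ} {S : ℕ → ℕ → ℕ → ℝ} {dep : ℕ → ℕ → ℝ → ℝ} {q : ℕ → ℝ} {l : ℕ}

theorem mass_le_totalMass (hq : q ∈ occupancySpace) (hs : Summable q) (a : ℕ) :
    mass q a ≤ totalMass q :=
  ((summable_nat_add_iff 1).2 hs).sum_le_tsum _ fun i _ => (hq.2 (i + 1)).1

theorem tendsto_mass (hs : Summable q) : Tendsto (mass q) atTop (𝓝 (totalMass q)) :=
  ((summable_nat_add_iff 1).2 hs).hasSum.tendsto_sum_nat

end Fluid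

/-! ### Outflows and threshold steps of a single system -/

namespace Dynamics

variable {n : ℕ} {α : ℝ} {x : ℝ → ℕ → ℝ} {A : ℝ → ℕ} {L : ℕ → ℕ} {pre S : ℕ → ℕ → ℝ}
  {dep : ℕ → ℝ → ℝ}

theorem intervalIntegrable_apply (h : Dynamics n α x A L pre S dep) (i : ℕ) {s t : ℝ} (hs : 0 ≤ s)
    (hst : s ≤ t) : IntervalIntegrable (fun u => x u i) volume s t := by
  refine (h.integrable i t (hs.trans hst)).mono_set ?_
  rw [Set.uIcc_of_le hst, Set.uIcc_of_le (hs.trans hst)]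
  exact Set.Icc_subset_Icc_left hs

theorem intervalIntegrable_mass (h : Dynamics n α x A L pre S dep) (a : ℕ) {s t : ℝ} (hs : 0 ≤ s)
    (hst : s ≤ t) : IntervalIntegrable (fun u => mass (x u) a) volume s t := by
  have := IntervalIntegrable.sum (Finset.range a) (f := fun i u => x u (i + 1)) (μ := volume)
    (a := s) (b := t) fun i _ => h.intervalIntegrable_apply (i + 1) hs hst
  refine this.congr fun u _ => ?_
  simp [mass]

/-- The cumulative outflow from pools with at most `a` tasks during `[s, t]`. -/
noncomputable def _root_.LoadBalancing.outflow (x : ℝ → ℕ → ℝ) (a : ℕ) (s t : ℝ) : ℝ :=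
  ∫ u in s..t, (mass (x u) a - a * x u (a + 1))

theorem intervalIntegrable_outflow (h : Dynamics n α x A L pre S dep) (a : ℕ) {s t : ℝ}
    (hs : 0 ≤ s) (hst : s ≤ t) :
    IntervalIntegrable (fun u => mass (x u) a - a * x u (a + 1)) volume s t :=
  (h.intervalIntegrable_mass a hs hst).sub ((h.intervalIntegrable_apply (a + 1) hs hst).const_mul _)

theorem outflow_nonneg (h : Dynamics n α x A L pre S dep) (a : ℕ) {s t : ℝ} (hs : 0 ≤ s)
    (hst : s ≤ t) : 0 ≤ outflow x a s t :=
  intervalIntegral.integral_nonneg hst fun u hu =>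
    sub_nonneg.2 (mul_succ_le_mass (h.mem u (hs.trans hu.1)) a)

theorem outflow_le (h : Dynamics n α x A L pre S dep) (a : ℕ) {s t : ℝ} (hs : 0 ≤ s)
    (hst : s ≤ t) {f : ℝ → ℝ} (hf : IntervalIntegrable f volume s t)
    (hle : ∀ u ∈ Set.Icc s t, mass (x u) a ≤ f u) : outflow x a s t ≤ ∫ u in s..t, f u := by
  refine intervalIntegral.integral_mono_on hst (h.intervalIntegrable_outflow a hs hst) hf
    fun u hu => ?_
  have h1 := hle u hu
  have h2 : 0 ≤ (a : ℝ) * x u (a + 1) :=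
    mul_nonneg (by positivity) ((h.mem u (hs.trans hu.1)).2 _).1
  linarith

theorem outflow_le_mul (h : Dynamics n α x A L pre S dep) (a : ℕ) {s t : ℝ} (hs : 0 ≤ s)
    (hst : s ≤ t) : outflow x a s t ≤ a * (t - s) := by
  have := h.outflow_le a hs hst (f := fun _ => (a : ℝ)) (by simp)
    fun u hu => mass_le (h.mem u (hs.trans hu.1)) a
  simpa [mul_comm] using this

theorem outflow_add (h : Dynamics n α x A L pre S dep) (a : ℕ) {s t : ℝ} (hs : 0 ≤ s)
    (hst : s ≤ t) : outflow x a 0 s + outflow x a s t = outflow x a 0 t :=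
  intervalIntegral.integral_add_adjacent_intervals (h.intervalIntegrable_outflow a le_rfl hs)
    (h.intervalIntegrable_outflow a hs hst)

theorem mass_sub_mass (h : Dynamics n α x A L pre S dep) (a : ℕ) {s t : ℝ} (hs : 0 ≤ s)
    (hst : s ≤ t) : mass (x t) a - mass (x s) a =
      (1 / (n : ℝ)) * ∑ j ∈ Finset.Ico (A s) (A t), S a j - (dep a t - dep a s) := by
  rw [h.mass_eq a t (hs.trans hst), h.mass_eq a s hs,
    ← Finset.sum_range_add_sum_Ico _ (h.count_mono hst)]
  ring

/-- An overflowing task also finds level `L j` full, hence above `α`, so no decrement offsets the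
increment. Overflows can thus be counted as up-steps. -/
theorem up_step (h : Dynamics n α x A L pre S dep) (hα : α < 1) {j : ℕ}
    (hj : pre j (L j + 1) = 1) : L (j + 1) = L j + 1 := by
  have h1 : pre j (L j) = 1 := le_antisymm (occupancySpace_le_one (h.pre_mem j) _)
    (hj ▸ ((h.pre_mem j).2 _).2)
  have h2 := h.step j
  rw [thresholdStep_eq_one (by rw [h1]; exact hα) (by
    rw [hj]; have : 0 ≤ 1 / (n : ℝ) := by positivity
    linarith)] at h2
  exact_mod_cast h2

theorem le_succ_add_one (h : Dynamics n α x A L pre S dep) (j : ℕ) : L j ≤ L (j + 1) + 1 := by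
  have h1 := h.step j
  have h2 := neg_one_le_thresholdStep n α (pre j) (L j)
  omega

theorem succ_le_add_one (h : Dynamics n α x A L pre S dep) (j : ℕ) : L (j + 1) ≤ L j + 1 := by
  have h1 := h.step j
  have h2 := thresholdStep_le_one n α (pre j) (L j)
  omega

theorem le_pre_of_up (h : Dynamics n α x A L pre S dep) {j : ℕ} (hj : L (j + 1) = L j + 1) :
    1 - 1 / (n : ℝ) ≤ pre j (L j + 1) := by
  refine le_of_thresholdStep_pos (α := α) ?_
  have h1 := h.step j
  omega

theorem pre_le_of_down (h : Dynamics n α x A L pre S dep) {j : ℕ} (hj : L (j + 1) < L j) :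
    pre j (L j) ≤ α := by
  refine le_of_thresholdStep_neg (n := n) (α := α) ?_
  have h1 := h.step j
  omega

end Dynamics

variable {α lam : ℝ} {x : ℕ → ℝ → ℕ → ℝ} {A : ℕ → ℝ → ℕ} {L : ℕ → ℕ → ℕ}
  {pre : ℕ → ℕ → ℕ → ℝ} {S : ℕ → ℕ → ℕ → ℝ} {dep : ℕ → ℕ → ℝ → ℝ} {q : ℕ → ℝ} {l : ℕ}

theorem eventually_one_div_natCast_le {ε : ℝ} (hε : 0 < ε) :
    ∀ᶠ n : ℕ in atTop, 1 / (n : ℝ) ≤ ε :=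
  (tendsto_one_div_atTop_nhds_zero_nat (𝕜 := ℝ)).eventually_le_const hε

/-! ### Uniform increment estimates and negligible overflow -/

namespace FluidSequence

theorem tendsto_mass_zero (h : FluidSequence α lam x A L pre S dep q l) (a : ℕ) :
    Tendsto (fun n => mass (x n 0) a) atTop (𝓝 (mass q a)) :=
  tendsto_finsetSum _ fun i _ => h.init (i + 1)

theorem eventually_count (h : FluidSequence α lam x A L pre S dep q l) (T : ℝ) {ε : ℝ}
    (hε : 0 < ε) : ∀ᶠ n : ℕ in atTop, ∀ s t, 0 ≤ s → s ≤ t → t ≤ T →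
      |(1 / (n : ℝ)) * ((A n t : ℝ) - A n s) - lam * (t - s)| ≤ ε := by
  filter_upwards [h.arrivals T (ε / 2) (by positivity)] with n hn s t hs hst ht
  have h1 := abs_le.1 (hn s ⟨hs, hst.trans ht⟩)
  have h2 := abs_le.1 (hn t ⟨hs.trans hst, ht⟩)
  rw [abs_le]
  constructor <;> linarith [h1.1, h1.2, h2.1, h2.2]

theorem eventually_increment (h : FluidSequence α lam x A L pre S dep q l) (a : ℕ) (T : ℝ) {ε : ℝ}
    (hε : 0 < ε) : ∀ᶠ n : ℕ in atTop, ∀ s t, 0 ≤ s → s ≤ t → t ≤ T →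
      |mass (x n t) a - mass (x n s) a - ((1 / (n : ℝ)) * ∑ j ∈ Finset.Ico (A n s) (A n t), S n a j
        - outflow (x n) a s t)| ≤ ε := by
  filter_upwards [h.departures a T (ε / 2) (by positivity), eventually_ge_atTop 1]
    with n hn hn1 s t hs hst ht
  have hd := h.dynamics n hn1
  have h1 := abs_le.1 (hn s ⟨hs, hst.trans ht⟩)
  have h2 := abs_le.1 (hn t ⟨hs.trans hst, ht⟩)
  have h3 := hd.outflow_add a hs hst
  have h4 := hd.mass_sub_mass a hs hst
  simp only [outflow] at h3 ⊢
  rw [abs_le]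
  constructor <;> linarith [h1.1, h1.2, h2.1, h2.2]

theorem eventually_increment_le (h : FluidSequence α lam x A L pre S dep q l) (a : ℕ) (T : ℝ)
    {ε : ℝ} (hε : 0 < ε) : ∀ᶠ n : ℕ in atTop, ∀ s t, 0 ≤ s → s ≤ t → t ≤ T →
      mass (x n t) a - mass (x n s) a ≤ lam * (t - s) - outflow (x n) a s t + ε := by
  filter_upwards [h.eventually_increment a T (half_pos hε), h.eventually_count T (half_pos hε),
    eventually_ge_atTop 1] with n h1 h2 hn s t hs hst ht
  have hd := h.dynamics n hn
  have h3 := (abs_le.1 (h1 s t hs hst ht)).2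
  have h4 := (abs_le.1 (h2 s t hs hst ht)).2
  have h5 : ∑ j ∈ Finset.Ico (A n s) (A n t), S n a j ≤ (A n t : ℝ) - A n s := by
    calc _ ≤ ∑ _j ∈ Finset.Ico (A n s) (A n t), (1 : ℝ) :=
          Finset.sum_le_sum fun j _ => hd.S_le_one a j
      _ = _ := by simp [Nat.cast_sub (hd.count_mono hst)]
  have h6 := mul_le_mul_of_nonneg_left h5 (show 0 ≤ 1 / (n : ℝ) by positivity)
  linarith

theorem eventually_le_increment (h : FluidSequence α lam x A L pre S dep q l) (a : ℕ) (T : ℝ)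
    {ε : ℝ} (hε : 0 < ε) : ∀ᶠ n : ℕ in atTop, ∀ s t, 0 ≤ s → s ≤ t → t ≤ T →
      - outflow (x n) a s t - ε ≤ mass (x n t) a - mass (x n s) a := by
  filter_upwards [h.eventually_increment a T hε, eventually_ge_atTop 1] with n h1 hn s t hs hst ht
  have hd := h.dynamics n hn
  have h3 := (abs_le.1 (h1 s t hs hst ht)).1
  have h5 : 0 ≤ ∑ j ∈ Finset.Ico (A n s) (A n t), S n a j :=
    Finset.sum_nonneg fun j _ => hd.S_nonneg a j
  have h6 := mul_nonneg (show 0 ≤ 1 / (n : ℝ) by positivity) h5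
  linarith

theorem eventually_abs_mass_sub_le (h : FluidSequence α lam x A L pre S dep q l) (a : ℕ) (T : ℝ)
    {ε : ℝ} (hε : 0 < ε) : ∀ᶠ n : ℕ in atTop, ∀ s t, 0 ≤ s → s ≤ t → t ≤ T →
      |mass (x n t) a - mass (x n s) a| ≤ (lam + a) * (t - s) + ε := by
  filter_upwards [h.eventually_increment_le a T hε, h.eventually_le_increment a T hε,
    eventually_ge_atTop 1] with n h1 h2 hn s t hs hst ht
  have hd := h.dynamics n hn
  have h3 := h1 s t hs hst ht
  have h4 := h2 s t hs hst ht
  have h5 := hd.outflow_nonneg a hs hst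
  have h6 := hd.outflow_le_mul a hs hst
  have h7 : 0 ≤ lam * (t - s) := mul_nonneg h.lam_pos.le (by linarith)
  have h8 : 0 ≤ (a : ℝ) * (t - s) := mul_nonneg (by positivity) (by linarith)
  rw [abs_le]
  constructor <;> linarith

/-- A single level is a difference of two truncated masses, each almost Lipschitz in time. -/
theorem eventually_abs_apply_sub_le (h : FluidSequence α lam x A L pre S dep q l) (a : ℕ) (T : ℝ)
    {ε : ℝ} (hε : 0 < ε) : ∀ᶠ n : ℕ in atTop, ∀ s t, 0 ≤ s → s ≤ t → t ≤ T →
      |x n t a - x n s a| ≤ 2 * (lam + a) * (t - s) + ε := by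
  rcases Nat.eq_zero_or_pos a with rfl | hpos
  · filter_upwards [eventually_ge_atTop 1] with n hn s t hs hst ht
    have hd := h.dynamics n hn
    rw [(hd.mem s hs).1, (hd.mem t (hs.trans hst)).1]
    have h7 : 0 ≤ (lam + (0 : ℕ)) * (t - s) :=
      mul_nonneg (by simpa using h.lam_pos.le) (by linarith)
    simp only [sub_self, abs_zero]
    linarith
  · obtain ⟨k, rfl⟩ : ∃ k, a = k + 1 := ⟨a - 1, by omega⟩
    filter_upwards [h.eventually_abs_mass_sub_le (k + 1) T (half_pos hε),
      h.eventually_abs_mass_sub_le k T (half_pos hε)] with n h1 h2 s t hs hst ht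
    have h3 := abs_le.1 (h1 s t hs hst ht)
    have h4 := abs_le.1 (h2 s t hs hst ht)
    rw [mass_succ, mass_succ] at h3
    push_cast at h3 ⊢
    rw [abs_le]
    constructor <;> nlinarith [h3.1, h3.2, h4.1, h4.2]

theorem eventually_mass_le (h : FluidSequence α lam x A L pre S dep q l) (a : ℕ) (T : ℝ) :
    ∀ᶠ n : ℕ in atTop, ∀ t ∈ Set.Icc 0 T, mass (x n t) a ≤ totalMass q + lam * T + 1 := by
  have h0 := (h.tendsto_mass_zero a).eventually_le_const
    (show mass q a < totalMass q + 1 / 2 by linarith [mass_le_totalMass h.mem h.summable a])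
  filter_upwards [h0, h.eventually_increment_le a T (half_pos one_pos), eventually_ge_atTop 1]
    with n h1 h2 hn t ht
  have hd := h.dynamics n hn
  have h3 := h2 0 t le_rfl ht.1 ht.2
  have h5 := hd.outflow_nonneg a le_rfl ht.1
  have h6 := mul_le_mul_of_nonneg_left ht.2 h.lam_pos.le
  linarith

/-- The thresholds remain bounded on bounded time intervals, uniformly in `n`. -/
theorem exists_threshold_le (h : FluidSequence α lam x A L pre S dep q l) (T : ℝ) :
    ∃ K, ∀ᶠ n : ℕ in atTop, ∀ j ≤ A n T, L n j ≤ K := by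
  -- Raising the threshold above `K` requires level `K + 1` to be at least `1 - 1 / n ≥ 2 / 3`,
  -- hence mass at least `2 * (K + 1) / 3`, more than `K / 2`, which is at least the available mass.
  obtain ⟨K₀, hK₀⟩ := exists_nat_ge (2 * (totalMass q + lam * T + 1))
  refine ⟨max l K₀, ?_⟩
  set K := max l K₀
  filter_upwards [h.eventually_mass_le (K + 1) T, h.init_threshold, eventually_ge_atTop 3]
    with n h1 h2 hn j
  have hd := h.dynamics n (by omega)
  induction j with
  | zero => intro _; rw [h2]; exact le_max_left _ _
  | succ j ih =>
    intro hj
    have hjK := ih (by omega)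
    have hs := hd.succ_le_add_one j
    by_contra hcon
    have hLj : L n j = K := by omega
    have hup : L n (j + 1) = L n j + 1 := by omega
    obtain ⟨r, hr0, hrT, -, hr⟩ := hd.pre_eq (K + 1) 0 T j le_rfl (by simp [hd.count_zero]) hj
    have h3 := hd.le_pre_of_up hup
    rw [hLj, hr _ le_rfl] at h3
    have h4 := (mul_le_mass (hd.mem r hr0) (K + 1)).trans (h1 r ⟨hr0, hrT.le⟩)
    have h5 : (K₀ : ℝ) ≤ K := by exact_mod_cast le_max_right l K₀
    have h6 : 1 / (n : ℝ) ≤ 1 / 3 := by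
      gcongr; exact_mod_cast hn
    push_cast at h4
    nlinarith

/-- The number of tasks sent to pools with more tasks than the threshold remains bounded. -/
theorem exists_card_overflow_le (h : FluidSequence α lam x A L pre S dep q l) (T : ℝ) :
    ∃ B : ℕ, ∀ᶠ n : ℕ in atTop,
      ((Finset.range (A n T)).filter fun j => L n (j + 1) = L n j + 1).card ≤ B := by
  rcases lt_or_ge T 0 with hT | hT
  · refine ⟨0, ?_⟩
    filter_upwards [eventually_ge_atTop 1] with n hn
    have hd := h.dynamics n hn
    have := hd.count_mono hT.le
    rw [hd.count_zero] at this
    have h0 : A n T = 0 := by omega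
    simp [h0]
  obtain ⟨K, hK⟩ := h.exists_threshold_le T
  have hα : 0 < 1 - α := by linarith [h.alpha_lt_one]
  have hC : 0 < lam + K := by have := h.lam_pos; positivity
  -- In a window of length `η` the levels up to `K` vary by at most `(1 - α) / 2`, whereas crossing
  -- an edge both ways would need a variation of at least `1 - 1 / n - α ≥ 3 * (1 - α) / 4`.
  set η : ℝ := (1 - α) / (8 * (lam + K)) with hη
  have hη0 : 0 < η := by positivity
  have hηC : 2 * (lam + K) * η = (1 - α) / 4 := by rw [hη]; field_simp; norm_num
  obtain ⟨W, hW⟩ := exists_nat_ge (T / η)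
  rw [div_le_iff₀ hη0] at hW
  refine ⟨W * K, ?_⟩
  have hlip : ∀ᶠ n : ℕ in atTop, ∀ a ∈ Finset.range (K + 1), ∀ s t, 0 ≤ s → s ≤ t → t ≤ T →
      |x n t a - x n s a| ≤ 2 * (lam + a) * (t - s) + (1 - α) / 4 :=
    (Finset.eventually_all _).2 fun a _ => h.eventually_abs_apply_sub_le a T (by positivity)
  filter_upwards [hK, hlip, eventually_ge_atTop 1,
    eventually_one_div_natCast_le (show 0 < (1 - α) / 4 by positivity)] with n h1 h2 hn hn'
  have hd := h.dynamics n hn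
  have hosc : ∀ a ≤ K, ∀ s t, 0 ≤ s → s ≤ t → t ≤ T → t - s ≤ η →
      |x n t a - x n s a| ≤ (1 - α) / 2 := by
    intro a ha s t hs hst ht hη'
    have h3 := h2 a (by simp; omega) s t hs hst ht
    have h4 : (a : ℝ) ≤ K := by exact_mod_cast ha
    have h5 : 2 * (lam + a) * (t - s) ≤ 2 * (lam + K) * η := by
      have := h.lam_pos
      have : 0 ≤ t - s := by linarith
      gcongr
    linarith
  have hwin : ∀ s t, 0 ≤ s → s ≤ t → t ≤ T → t - s ≤ η →
      ((Finset.Ico (A n s) (A n t)).filter fun j => L n (j + 1) = L n j + 1).card ≤ K := by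
    intro s t hs hst ht hη'
    refine card_up_steps_le hd.le_succ_add_one
      (fun j _ hj => h1 (j + 1) (le_trans hj (hd.count_mono ht))) ?_
    intro i j hi hi' hj hj' hup hLj hdown
    obtain ⟨r, hr1, hr2, -, hr⟩ := hd.pre_eq (L n i + 1) s t i hs hi hi'
    obtain ⟨r', hr1', hr2', -, hr'⟩ := hd.pre_eq (L n i + 1) s t j hs hj hj'
    have h3 := hd.le_pre_of_up hup
    have h4 := hd.pre_le_of_down (j := j) (by omega)
    rw [hLj, hr' _ le_rfl] at h4
    rw [hr _ le_rfl] at h3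
    have hle : L n i + 1 ≤ K := hup ▸ h1 (i + 1) (le_trans hi' (hd.count_mono ht))
    rcases le_total r r' with hrr | hrr
    · have := abs_le.1 (hosc _ hle r r' (by linarith) hrr (by linarith) (by linarith))
      linarith [this.1]
    · have := abs_le.1 (hosc _ hle r' r (by linarith) hrr (by linarith) (by linarith))
      linarith [this.2]
  -- Each window contains at most `K` up-steps, and `W` windows cover `[0, T]`.
  have hind : ∀ w : ℕ,
      ((Finset.range (A n (min (w * η) T))).filter fun j => L n (j + 1) = L n j + 1).card
        ≤ w * K := by
    intro w
    induction w with
    | zero => simp [min_eq_left hT, hd.count_zero]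
    | succ w ih =>
      have hle : min (w * η) T ≤ min ((w + 1 : ℕ) * η) T := by
        refine min_le_min_right _ ?_
        push_cast; nlinarith
      have hs0 : 0 ≤ min (w * η) T := le_min (by positivity) hT
      have hdiff : min ((w + 1 : ℕ) * η) T - min (w * η) T ≤ η := by
        push_cast
        rcases le_total (w * η) T with hc | hc
        · rw [min_eq_left hc]
          linarith [min_le_left (((w : ℝ) + 1) * η) T]
        · rw [min_eq_right hc]
          linarith [min_le_right (((w : ℝ) + 1) * η) T]
      have h3 := hwin _ _ hs0 hle (min_le_right _ _) hdiff
      have h4 : Finset.range (A n (min ((w + 1 : ℕ) * η) T)) =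
          Finset.range (A n (min (w * η) T)) ∪
            Finset.Ico (A n (min (w * η) T)) (A n (min ((w + 1 : ℕ) * η) T)) := by
        have := hd.count_mono hle
        ext j
        simp only [Finset.mem_union, Finset.mem_range, Finset.mem_Ico]
        omega
      rw [h4, Finset.filter_union]
      refine (Finset.card_union_le _ _).trans ?_
      calc _ ≤ w * K + K := Nat.add_le_add ih h3
        _ = (w + 1) * K := by ring
  have := hind W
  rwa [min_eq_right hW] at this

/-- If all tasks arriving during `[s, t]` are eligible for pools with fewer than `a` tasks, then
the mass up to level `a` grows at rate `lam`, up to departures. -/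
theorem eventually_le_increment_of_eligible (h : FluidSequence α lam x A L pre S dep q l) (a : ℕ)
    (T : ℝ) {ε : ℝ} (hε : 0 < ε) : ∀ᶠ n : ℕ in atTop, ∀ s t, 0 ≤ s → s ≤ t → t ≤ T →
      (∀ r ∈ Set.Ico s t, L n (A n r) < a ∨ (L n (A n r) = a ∧ x n r a < 1)) →
      lam * (t - s) - outflow (x n) a s t - ε ≤ mass (x n t) a - mass (x n s) a := by
  obtain ⟨B, hB⟩ := h.exists_card_overflow_le T
  have hε3 : 0 < ε / 3 := by positivity
  filter_upwards [h.eventually_increment a T hε3, h.eventually_count T hε3, hB,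
    eventually_ge_atTop 1,
    eventually_one_div_natCast_le (show 0 < ε / 3 / (B + 1) by positivity)]
    with n h1 h2 hBn hn hnB s t hs hst ht helig
  have hd := h.dynamics n hn
  have h3 := (abs_le.1 (h1 s t hs hst ht)).1
  have h4 := (abs_le.1 (h2 s t hs hst ht)).1
  have h5 : (A n t : ℝ) - A n s - B ≤ ∑ j ∈ Finset.Ico (A n s) (A n t), S n a j := by
    -- All tasks that raise the threshold are given up; every other task did not overflow, so
    -- eligibility determines its destination.
    have hterm : ∀ j ∈ Finset.Ico (A n s) (A n t),
        1 - (if L n (j + 1) = L n j + 1 then (1 : ℝ) else 0) ≤ S n a j := by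
      intro j hj
      rw [Finset.mem_Ico] at hj
      split_ifs with hup
      · simpa using hd.S_nonneg a j
      · obtain ⟨r, hr1, hr2, hr3, hr⟩ := hd.pre_eq a s t j hs hj.1 hj.2
        have := helig r ⟨hr1, hr2⟩
        rw [hr3, ← hr a le_rfl] at this
        rw [hd.S_eq_one a j (fun ho => hup (hd.up_step h.alpha_lt_one ho)) this]
        simp
    have hcard : ((Finset.Ico (A n s) (A n t)).filter fun j => L n (j + 1) = L n j + 1).card
        ≤ B := by
      refine (Finset.card_le_card ?_).trans hBn
      intro j hj
      simp only [Finset.mem_filter, Finset.mem_Ico, Finset.mem_range] at hj ⊢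
      exact ⟨hj.1.2.trans_le (hd.count_mono ht), hj.2⟩
    have hsum := Finset.sum_le_sum hterm
    rw [Finset.sum_sub_distrib, Finset.sum_boole] at hsum
    simp only [Finset.sum_const, Nat.card_Ico, nsmul_eq_mul, mul_one,
      Nat.cast_sub (hd.count_mono hst)] at hsum
    have : ((((Finset.Ico (A n s) (A n t)).filter
        fun j => L n (j + 1) = L n j + 1).card : ℕ) : ℝ) ≤ B := by exact_mod_cast hcard
    linarith
  have h6 := mul_le_mul_of_nonneg_left h5 (show 0 ≤ 1 / (n : ℝ) by positivity)
  have h7 : 1 / (n : ℝ) * B ≤ ε / 3 := by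
    have := mul_le_mul_of_nonneg_right hnB (show (0 : ℝ) ≤ B by positivity)
    refine this.trans ?_
    rw [div_mul_eq_mul_div, div_le_iff₀ (by positivity)]
    nlinarith
  linarith

end FluidSequence

/-! ### Comparison with exponentials -/

/-- After the last visit `z` to nonnegative values, `h2` allows a loss of only `ε`. Since `f` may
jump, `z` need not itself be a visit; `h1` bridges a short interval around it at the cost of a
second `ε`. -/
theorem neg_le_of_barrier {f : ℝ → ℝ} {a b K ε : ℝ} (hK : 0 ≤ K) (hε : 0 ≤ ε) (ha : 0 ≤ f a)
    (h1 : ∀ s t, a ≤ s → s ≤ t → t ≤ b → f s - K * (t - s) - ε ≤ f t)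
    (h2 : ∀ s t, a ≤ s → s ≤ t → t ≤ b → (∀ r ∈ Set.Icc s t, f r < 0) → f s - ε ≤ f t)
    {t : ℝ} (ht : t ∈ Set.Icc a b) : -(2 * ε) ≤ f t := by
  by_contra! hlt
  set G : Set ℝ := {s | s ∈ Set.Icc a t ∧ 0 ≤ f s} with hG
  have hGa : a ∈ G := ⟨⟨le_rfl, ht.1⟩, ha⟩
  have hGbd : BddAbove G := ⟨t, fun s hs => hs.1.2⟩
  set z := sSup G with hz
  have hzt : z ≤ t := csSup_le ⟨a, hGa⟩ fun s hs => hs.1.2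
  have haz : a ≤ z := le_csSup hGbd hGa
  -- The bridge has length at most `2 * δ`, so its cost `2 * K * δ` is less than the assumed excess
  -- `4 * (K + 1) * δ`.
  set δ : ℝ := (-(2 * ε) - f t) / (4 * (K + 1)) with hδ
  have hδ0 : 0 < δ := div_pos (by linarith) (by positivity)
  have hKδ : 4 * (K + 1) * δ = -(2 * ε) - f t := by rw [hδ]; field_simp
  obtain ⟨s, hs, hsz⟩ := exists_lt_of_lt_csSup ⟨a, hGa⟩ (show z - δ < sSup G by linarith)
  have hsz' : s ≤ z := le_csSup hGbd hs
  have hKd : 0 ≤ K * δ := by positivity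
  rcases le_or_gt t (z + δ) with hc | hc
  · have h3 := h1 s t hs.1.1 hs.1.2 ht.2
    have h4 : K * (t - s) ≤ K * (2 * δ) := mul_le_mul_of_nonneg_left (by linarith) hK
    linarith [hs.2]
  · have h3 := h1 s (z + δ) hs.1.1 (by linarith) (by linarith [ht.2])
    have h4 : K * (z + δ - s) ≤ K * (2 * δ) := mul_le_mul_of_nonneg_left (by linarith) hK
    have h5 := h2 (z + δ) t (by linarith) hc.le ht.2 (by
      intro r hr
      by_contra! hr0
      have : r ≤ z := le_csSup hGbd ⟨⟨by linarith [hr.1], hr.2⟩, hr0⟩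
      linarith [hr.1])
    linarith [hs.2]

/-- The solution of `y' = ρ (c - y)` with `y a = c + d`. -/
noncomputable def relaxation (ρ c d a t : ℝ) : ℝ := c + d * Real.exp (-(ρ * (t - a)))

theorem continuous_relaxation (ρ c d a : ℝ) : Continuous (relaxation ρ c d a) := by
  unfold relaxation; fun_prop

theorem relaxation_self (ρ c d a : ℝ) : relaxation ρ c d a a = c + d := by simp [relaxation]

theorem relaxation_neg (ρ c d a t : ℝ) : relaxation ρ (-c) (-d) a t = -relaxation ρ c d a t := by
  simp only [relaxation]; ring

theorem hasDerivAt_relaxation (ρ c d a t : ℝ) :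
    HasDerivAt (relaxation ρ c d a) (ρ * (c - relaxation ρ c d a t)) t := by
  have h1 : HasDerivAt (fun u : ℝ => -(ρ * (u - a))) (-ρ) t := by
    simpa using (((hasDerivAt_id t).sub_const a).const_mul ρ).fun_neg
  have h2 : HasDerivAt (relaxation ρ c d a) _ t := (h1.exp.const_mul d).const_add c
  refine h2.congr_deriv ?_
  simp only [relaxation]; ring

theorem relaxation_sub (ρ c d a s t : ℝ) : relaxation ρ c d a t - relaxation ρ c d a s =
    ρ * (c * (t - s) - ∫ u in s..t, relaxation ρ c d a u) := by
  have hcont := continuous_relaxation ρ c d a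
  have h1 := intervalIntegral.integral_eq_sub_of_hasDerivAt
    (fun u _ => hasDerivAt_relaxation ρ c d a u) (a := s) (b := t)
    (by apply Continuous.intervalIntegrable; fun_prop)
  rw [← h1, intervalIntegral.integral_const_mul, intervalIntegral.integral_sub (by simp)
    (hcont.intervalIntegrable _ _)]
  simp [mul_comm]

theorem abs_relaxation_sub_le {ρ c d a s t : ℝ} (hρ : 0 ≤ ρ) (has : a ≤ s) (hst : s ≤ t) :
    |relaxation ρ c d a t - relaxation ρ c d a s| ≤ |d| * ρ * (t - s) := by
  have h0 : 0 ≤ ρ * (t - s) := mul_nonneg hρ (by linarith)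
  have e1 : relaxation ρ c d a t - relaxation ρ c d a s =
      d * (Real.exp (-(ρ * (s - a))) * (Real.exp (-(ρ * (t - s))) - 1)) := by
    have e2 : Real.exp (-(ρ * (t - a))) =
        Real.exp (-(ρ * (s - a))) * Real.exp (-(ρ * (t - s))) := by
      rw [← Real.exp_add]; ring_nf
    simp only [relaxation]
    rw [e2]
    ring
  have h1 : Real.exp (-(ρ * (s - a))) ≤ 1 :=
    Real.exp_le_one_iff.2 (neg_nonpos.2 (mul_nonneg hρ (by linarith)))
  have h2 := Real.add_one_le_exp (-(ρ * (t - s)))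
  have h3 : Real.exp (-(ρ * (t - s))) ≤ 1 := Real.exp_le_one_iff.2 (by linarith)
  rw [e1, abs_mul, abs_mul, mul_assoc]
  refine mul_le_mul_of_nonneg_left ?_ (abs_nonneg d)
  rw [abs_of_pos (Real.exp_pos _), abs_of_nonpos (by linarith)]
  calc _ ≤ 1 * (-(Real.exp (-(ρ * (t - s))) - 1)) :=
        mul_le_mul_of_nonneg_right h1 (by linarith)
    _ ≤ _ := by linarith

/-- An approximate Gronwall comparison. The drift bound is needed only while `F` is below the curve,
exactly when the outflow can be bounded by the integral of the curve. Upper bounds follow by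
changing signs. -/
theorem relaxation_le_of_barrier {F : ℝ → ℝ} {ρ c d a b K ε : ℝ} (hρ : 0 ≤ ρ) (hK : 0 ≤ K)
    (hε : 0 ≤ ε) (ha : c + d ≤ F a)
    (h1 : ∀ s t, a ≤ s → s ≤ t → t ≤ b → F s - K * (t - s) - ε ≤ F t)
    (h2 : ∀ s t, a ≤ s → s ≤ t → t ≤ b → (∀ r ∈ Set.Icc s t, F r < relaxation ρ c d a r) →
      F s + ρ * (c * (t - s) - ∫ u in s..t, relaxation ρ c d a u) - ε ≤ F t)
    {t : ℝ} (ht : t ∈ Set.Icc a b) : relaxation ρ c d a t - 2 * ε ≤ F t := by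
  have key := neg_le_of_barrier (f := fun u => F u - relaxation ρ c d a u) (a := a) (b := b)
    (K := K + |d| * ρ) (ε := ε) (by positivity) hε (by rw [relaxation_self]; linarith)
    (fun s t hs hst ht => by
      have h3 := h1 s t hs hst ht
      have h4 := (abs_le.1 (abs_relaxation_sub_le (c := c) (d := d) hρ hs hst)).2
      linarith)
    (fun s t hs hst ht hneg => by
      have h3 := h2 s t hs hst ht fun r hr => by have := hneg r hr; linarith
      have h4 := relaxation_sub ρ c d a s t
      linarith) ht
  linarith

/-! ### Tails and the total mass -/

theorem sub_mul_le_mass_sub {q : ℕ → ℝ} (hq : q ∈ occupancySpace) {k a : ℕ} (hka : k ≤ a) :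
    ((a : ℝ) - k) * q (a + 1) ≤ mass q a - mass q k := by
  induction a, hka using Nat.le_induction with
  | base => simp
  | succ a hka ih =>
    have h1 := (hq.2 (a + 1)).2
    have h2 : (k : ℝ) ≤ a := by exact_mod_cast hka
    rw [mass_succ]
    push_cast
    nlinarith

/-- For `a ≥ 2 * k`, half of `a * q (a + 1)` is bounded by the mass beyond level `k`. This term is
the defect between the outflow rate and the truncated mass. -/
theorem eventually_mul_succ_le {q : ℕ → ℝ} (hq : q ∈ occupancySpace) (hs : Summable q) {ε : ℝ}
    (hε : 0 < ε) : ∀ᶠ a : ℕ in atTop, a * q (a + 1) ≤ ε := by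
  obtain ⟨k, hk⟩ := ((tendsto_mass hs).eventually_const_le
    (show totalMass q - ε / 2 < totalMass q by linarith)).exists
  filter_upwards [eventually_ge_atTop (2 * k)] with a ha
  have h1 := sub_mul_le_mass_sub hq (show k ≤ a by omega)
  have h2 := mass_le_totalMass hq hs a
  have h3 : 2 * (k : ℝ) ≤ a := by exact_mod_cast ha
  have h4 := (hq.2 (a + 1)).1
  nlinarith

theorem Dynamics.outflow_le_outflow_succ {n : ℕ} {α : ℝ} {x : ℝ → ℕ → ℝ} {A : ℝ → ℕ} {L : ℕ → ℕ}
    {pre S : ℕ → ℕ → ℝ} {dep : ℕ → ℝ → ℝ} (h : Dynamics n α x A L pre S dep) (a : ℕ) {s t : ℝ}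
    (hs : 0 ≤ s) (hst : s ≤ t) : outflow x a s t ≤ outflow x (a + 1) s t := by
  refine intervalIntegral.integral_mono_on hst (h.intervalIntegrable_outflow a hs hst)
    (h.intervalIntegrable_outflow (a + 1) hs hst) fun u hu => ?_
  have h1 := ((h.mem u (hs.trans hu.1)).2 (a + 1)).2
  rw [mass_succ]
  push_cast
  nlinarith

theorem Dynamics.le_outflow {n : ℕ} {α : ℝ} {x : ℝ → ℕ → ℝ} {A : ℝ → ℕ} {L : ℕ → ℕ}
    {pre S : ℕ → ℕ → ℝ} {dep : ℕ → ℝ → ℝ} (h : Dynamics n α x A L pre S dep) (a : ℕ) {s t : ℝ}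
    (hs : 0 ≤ s) (hst : s ≤ t) {f : ℝ → ℝ} (hf : IntervalIntegrable f volume s t)
    (hle : ∀ u ∈ Set.Icc s t, f u ≤ mass (x u) a - a * x u (a + 1)) :
    ∫ u in s..t, f u ≤ outflow x a s t :=
  intervalIntegral.integral_mono_on hst hf (h.intervalIntegrable_outflow a hs hst) hle

namespace FluidSequence

variable {α lam : ℝ} {x : ℕ → ℝ → ℕ → ℝ} {A : ℕ → ℝ → ℕ} {L : ℕ → ℕ → ℕ}
  {pre : ℕ → ℕ → ℕ → ℝ} {S : ℕ → ℕ → ℕ → ℝ} {dep : ℕ → ℕ → ℝ → ℝ} {q : ℕ → ℝ} {l : ℕ}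

/-- Levels far above the threshold receive a negligible number of tasks. -/
theorem eventually_apply_le (h : FluidSequence α lam x A L pre S dep q l) {T : ℝ} {K a : ℕ}
    (hK : ∀ᶠ n : ℕ in atTop, ∀ j ≤ A n T, L n j ≤ K) (ha : K < a) {ε : ℝ} (hε : 0 < ε) :
    ∀ᶠ n : ℕ in atTop, ∀ t ∈ Set.Icc 0 T, x n t (a + 1) ≤ q (a + 1) + ε := by
  have hε3 : 0 < ε / 3 := by positivity
  filter_upwards [hK, h.eventually_increment_le (a + 1) T hε3,
    h.eventually_le_increment_of_eligible a T hε3,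
    (h.init (a + 1)).eventually_le_const (show q (a + 1) < q (a + 1) + ε / 3 by linarith),
    eventually_ge_atTop 1] with n h1 h2 h3 h4 hn t ht
  have hd := h.dynamics n hn
  -- The mass up to `a + 1` gains at most all arrivals, while the mass up to `a` already gains
  -- almost all of them; the difference leaves nothing for level `a + 1`.
  have h5 := h2 0 t le_rfl ht.1 ht.2
  have h6 := h3 0 t le_rfl ht.1 ht.2 fun r hr =>
    Or.inl (lt_of_le_of_lt (h1 _ (hd.count_mono (hr.2.le.trans ht.2))) ha)
  have h7 := hd.outflow_le_outflow_succ a le_rfl ht.1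
  rw [mass_succ, mass_succ] at h5
  linarith

/-- The truncated total mass converges to the total mass of an infinite-server queue. -/
theorem eventually_forall_abs_mass_sub_le (h : FluidSequence α lam x A L pre S dep q l) {T ε : ℝ}
    (hT : 0 ≤ T) (hε : 0 < ε) : ∀ᶠ M : ℕ in atTop, ∀ᶠ n : ℕ in atTop, ∀ t ∈ Set.Icc 0 T,
      |mass (x n t) M - relaxation 1 lam (totalMass q - lam) 0 t| ≤ ε ∧
        M * x n t (M + 1) ≤ ε := by
  obtain ⟨K, hK⟩ := h.exists_threshold_le T
  set κ : ℝ := min (ε / 3) (ε / (3 * (T + 1))) with hκ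
  have hκ0 : 0 < κ := lt_min (by positivity) (by positivity)
  have hκε : 3 * κ ≤ ε := by linarith [min_le_left (ε / 3) (ε / (3 * (T + 1)))]
  set u := totalMass q
  filter_upwards [eventually_gt_atTop K, eventually_mul_succ_le h.mem h.summable (half_pos hκ0),
    (tendsto_mass h.summable).eventually_const_le (show u - κ / 2 < u by linarith)]
    with M hMK hMq hMu
  have hκM : 0 < κ / (2 * (M + 1)) := by positivity
  have hmass := h.tendsto_mass_zero M
  have hMu' := mass_le_totalMass h.mem h.summable M
  filter_upwards [hK, h.eventually_apply_le hK hMK hκM,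
    h.eventually_increment_le M T hκ0, h.eventually_le_increment_of_eligible M T hκ0,
    h.eventually_abs_mass_sub_le M T hκ0,
    hmass.eventually_le_const (show mass q M < u + κ by linarith),
    hmass.eventually_const_le (show u - κ < mass q M by linarith),
    eventually_ge_atTop 1] with n h1 h2 h3 h4 h5 h6 h7 hn
  have hd := h.dynamics n hn
  have htail : ∀ t ∈ Set.Icc 0 T, M * x n t (M + 1) ≤ κ := by
    intro t ht
    have h8 := mul_le_mul_of_nonneg_left (h2 t ht) (show (0 : ℝ) ≤ M by positivity)
    have h9 : (M : ℝ) * (κ / (2 * (M + 1))) ≤ κ / 2 := by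
      rw [mul_div_assoc', div_le_div_iff₀ (by positivity) (by positivity)]
      nlinarith
    linarith
  have hKC : 0 ≤ lam + M := by have := h.lam_pos; positivity
  have hint : ∀ c d s t : ℝ, IntervalIntegrable (relaxation 1 c d 0) volume s t :=
    fun c d s t => (continuous_relaxation 1 c d 0).intervalIntegrable s t
  intro t ht
  have hlow := relaxation_le_of_barrier (F := fun t => mass (x n t) M + κ) (ρ := 1) (c := lam)
    (d := u - lam) (a := 0) (b := T) zero_le_one hKC hκ0.le (by linarith)
    (fun s t hs hst ht => by
      have := (abs_le.1 (h5 s t hs hst ht)).1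
      linarith)
    (fun s t hs hst ht hlt => by
      have h8 := h4 s t hs hst ht fun r hr =>
        Or.inl (lt_of_le_of_lt (h1 _ (hd.count_mono (hr.2.le.trans ht))) hMK)
      have h9 := hd.outflow_le M hs hst (hint lam (u - lam) s t)
        fun r hr => by have := hlt r hr; linarith
      linarith) ht
  -- The shift by `κ` pays for the tail: where the mass exceeds the curve by `κ`, the outflow rate
  -- still dominates the curve.
  have hupp := relaxation_le_of_barrier (F := fun t => -mass (x n t) M + κ) (ρ := 1) (c := -lam)
    (d := -(u - lam)) (a := 0) (b := T) zero_le_one hKC hκ0.le (by linarith)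
    (fun s t hs hst ht => by
      have := (abs_le.1 (h5 s t hs hst ht)).2
      linarith)
    (fun s t hs hst ht hlt => by
      have h8 := h3 s t hs hst ht
      have h9 := hd.le_outflow M hs hst (hint lam (u - lam) s t)
        fun r hr => by
          have := hlt r hr
          rw [relaxation_neg] at this
          linarith [htail r ⟨hs.trans hr.1, hr.2.trans ht⟩]
      simp only [relaxation_neg, intervalIntegral.integral_neg]
      linarith) ht
  rw [relaxation_neg] at hupp
  refine ⟨abs_le.2 ⟨by linarith, by linarith⟩, (htail t ht).trans (by linarith)⟩

end FluidSequence

namespace FluidSequence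

variable {α lam : ℝ} {x : ℕ → ℝ → ℕ → ℝ} {A : ℕ → ℝ → ℕ} {L : ℕ → ℕ → ℕ}
  {pre : ℕ → ℕ → ℕ → ℝ} {S : ℕ → ℕ → ℕ → ℝ} {dep : ℕ → ℕ → ℝ → ℝ} {q : ℕ → ℝ} {l : ℕ}

/-! ### Upper bounds for the threshold -/

/-- An increase from `m` would need level `m + 1` to be at least `1 - 1 / n`, which exceeds `c` for
large `n`. -/
theorem eventually_threshold_le_of_init (h : FluidSequence α lam x A L pre S dep q l) {T c : ℝ}
    {m : ℕ} (hc : c < 1) (hl : l ≤ m)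
    (hx : ∀ᶠ n : ℕ in atTop, ∀ t ∈ Set.Icc 0 T, x n t (m + 1) ≤ c) :
    ∀ᶠ n : ℕ in atTop, ∀ t ∈ Set.Icc 0 T, L n (A n t) ≤ m := by
  filter_upwards [hx, h.init_threshold, eventually_ge_atTop 1,
    eventually_one_div_natCast_le (show 0 < (1 - c) / 2 by linarith)] with n h1 h2 hn hn' t ht
  have hd := h.dynamics n hn
  have key : ∀ j ≤ A n T, L n j ≤ m := by
    intro j
    induction j with
    | zero => intro _; omega
    | succ j ih =>
      intro hj
      have hjm := ih (by omega)
      by_contra hcon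
      have hs := hd.succ_le_add_one j
      have hLj : L n j = m := by omega
      obtain ⟨r, hr0, hrT, -, hr⟩ := hd.pre_eq (m + 1) 0 T j le_rfl (by simp [hd.count_zero]) hj
      have h3 := hd.le_pre_of_up (show L n (j + 1) = L n j + 1 by omega)
      rw [hLj, hr _ le_rfl] at h3
      linarith [h1 r ⟨hr0, hrT.le⟩]
  exact key _ (hd.count_mono ht.2)

/-- Above `m` every arrival lowers the threshold by one, and at `m` none raises it. Since the
threshold is at most a fixed `K`, boundedly many arrivals suffice, and they occur within any `δ`. -/
theorem eventually_threshold_le (h : FluidSequence α lam x A L pre S dep q l) {s₀ T δ : ℝ}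
    {m : ℕ} (hs₀ : 0 ≤ s₀) (hδ : 0 < δ)
    (hx : ∀ᶠ n : ℕ in atTop, ∀ t ∈ Set.Icc s₀ T, x n t (m + 1) ≤ α) :
    ∀ᶠ n : ℕ in atTop, ∀ t ∈ Set.Icc (s₀ + δ) T, L n (A n t) ≤ m := by
  obtain ⟨K, hK⟩ := h.exists_threshold_le T
  have hα := h.alpha_lt_one
  have hlδ : 0 < lam * δ := mul_pos h.lam_pos hδ
  filter_upwards [hx, hK, h.eventually_count T (half_pos hlδ), eventually_ge_atTop 1,
    eventually_one_div_natCast_le (show 0 < (1 - α) / 2 by linarith),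
    eventually_one_div_natCast_le (show 0 < lam * δ / 2 / (K + 1) by positivity)]
    with n h1 h2 h3 hn hn' hnK t ht
  have hd := h.dynamics n hn
  have hst : s₀ ≤ t := by linarith [ht.1]
  -- Either the threshold has come down to `m`, or it has dropped at every arrival since `s₀`.
  have key : ∀ j, A n s₀ ≤ j → j ≤ A n t → L n j ≤ m ∨ L n j + (j - A n s₀) ≤ K := by
    intro j hj
    induction j, hj using Nat.le_induction with
    | base => intro hj; exact Or.inr (by have := h2 _ (hj.trans (hd.count_mono ht.2)); omega)
    | succ j hj ih =>
      intro hjt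
      obtain ⟨r, hr0, hrT, -, hr⟩ := hd.pre_eq (max m (L n j) + 1) s₀ t j hs₀ hj hjt
      have hanti := occupancySpace_antitone (hd.mem r (hs₀.trans hr0))
      have hxr := h1 r ⟨hr0, by linarith [ht.2]⟩
      rcases le_or_gt (L n j) m with hm | hm
      · left
        by_contra hcon
        have hs := hd.succ_le_add_one j
        have hLj : L n j = m := by omega
        have h4 := hd.le_pre_of_up (show L n (j + 1) = L n j + 1 by omega)
        rw [hLj, hr _ (by omega)] at h4
        linarith
      · have h4 : pre n j (L n j) ≤ α := by
          rw [hr _ (by omega)]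
          exact (hanti (show m + 1 ≤ L n j by omega)).trans hxr
        have h5 : pre n j (L n j + 1) < 1 - 1 / (n : ℝ) := by
          have := ((hd.pre_mem j).2 (L n j)).2
          linarith
        have h6 := hd.step j
        rw [thresholdStep_eq_neg_one h4 h5] at h6
        rcases ih (by omega) with h7 | h7
        · omega
        · right; omega
  rcases key (A n t) (hd.count_mono hst) le_rfl with h4 | h4
  · exact h4
  · exfalso
    have hn0 : (0 : ℝ) < n := by exact_mod_cast hn
    have h5 := (abs_le.1 (h3 s₀ t hs₀ hst ht.2)).1
    have h6 : lam * δ ≤ lam * (t - s₀) :=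
      mul_le_mul_of_nonneg_left (by linarith [ht.1]) h.lam_pos.le
    have hmono := hd.count_mono hst
    have h7 : ((A n t : ℝ) - A n s₀) ≤ K := by
      have : A n t ≤ K + A n s₀ := by omega
      have : (A n t : ℝ) ≤ K + A n s₀ := by exact_mod_cast this
      linarith
    have h8 : 1 / (n : ℝ) * ((A n t : ℝ) - A n s₀) ≤ 1 / (n : ℝ) * K :=
      mul_le_mul_of_nonneg_left h7 (by positivity)
    rw [le_div_iff₀ (by positivity)] at hnK
    have h9 : 0 < 1 / (n : ℝ) := by positivity
    linarith

/-! ### Lower bounds for occupancies -/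

/-- Arrivals only increase level `a + 1`, and departures reduce it at rate at most `a + 1` times its
size. -/
theorem eventually_le_apply (h : FluidSequence α lam x A L pre S dep q l) (a : ℕ) (T : ℝ) {ε : ℝ}
    (hε : 0 < ε) : ∀ᶠ n : ℕ in atTop, ∀ t ∈ Set.Icc 0 T,
      q (a + 1) * Real.exp (-((a + 1 : ℕ) * t)) - ε ≤ x n t (a + 1) := by
  set κ : ℝ := ε / 4 with hκ
  have hκ0 : 0 < κ := by positivity
  have hκ2 : 0 < κ / 2 := by positivity
  filter_upwards [h.eventually_increment (a + 1) T hκ2, h.eventually_increment a T hκ2,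
    h.eventually_abs_apply_sub_le (a + 1) T hκ0,
    (h.init (a + 1)).eventually_const_le (show q (a + 1) - κ < q (a + 1) by linarith),
    eventually_ge_atTop 1] with n h1 h2 h3 h4 hn t ht
  have hd := h.dynamics n hn
  have hKC : 0 ≤ 2 * (lam + ((a + 1 : ℕ) : ℝ)) := by have := h.lam_pos; positivity
  have := relaxation_le_of_barrier (F := fun t => x n t (a + 1) + κ) (ρ := ((a + 1 : ℕ) : ℝ))
    (c := 0) (d := q (a + 1)) (a := 0) (b := T) (by positivity) hKC hκ0.le (by linarith)
    (fun s t hs hst ht => by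
      have := (abs_le.1 (h3 s t hs hst ht)).1
      linarith)
    (fun s t hs hst ht hlt => by
      have h5 := (abs_le.1 (h1 s t hs hst ht)).1
      have h6 := (abs_le.1 (h2 s t hs hst ht)).2
      have h7 : (1 / (n : ℝ)) * ∑ j ∈ Finset.Ico (A n s) (A n t), S n a j ≤
          (1 / (n : ℝ)) * ∑ j ∈ Finset.Ico (A n s) (A n t), S n (a + 1) j :=
        mul_le_mul_of_nonneg_left (Finset.sum_le_sum fun j _ => hd.S_le_succ a j) (by positivity)
      have hint := (continuous_relaxation ((a + 1 : ℕ) : ℝ) 0 (q (a + 1)) 0).intervalIntegrable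
        (μ := volume) s t
      have h8 : outflow (x n) (a + 1) s t - outflow (x n) a s t ≤
          ((a + 1 : ℕ) : ℝ) * ∫ u in s..t, relaxation ((a + 1 : ℕ) : ℝ) 0 (q (a + 1)) 0 u := by
        rw [outflow, outflow, ← intervalIntegral.integral_sub
          (hd.intervalIntegrable_outflow (a + 1) hs hst) (hd.intervalIntegrable_outflow a hs hst),
          ← intervalIntegral.integral_const_mul]
        refine intervalIntegral.integral_mono_on hst
          ((hd.intervalIntegrable_outflow (a + 1) hs hst).sub
            (hd.intervalIntegrable_outflow a hs hst)) (hint.const_mul _) fun u hu => ?_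
        have h9 := hlt u hu
        have h10 := ((hd.mem u (hs.trans hu.1)).2 (a + 1 + 1)).1
        have h11 : ((a + 1 : ℕ) : ℝ) * x n u (a + 1) ≤
            ((a + 1 : ℕ) : ℝ) * relaxation ((a + 1 : ℕ) : ℝ) 0 (q (a + 1)) 0 u :=
          mul_le_mul_of_nonneg_left (by linarith) (by positivity)
        have h12 := mul_nonneg (show (0 : ℝ) ≤ ((a + 1 : ℕ) : ℝ) by positivity) h10
        rw [mass_succ]
        push_cast at h11 h12 ⊢
        linarith
      rw [mass_succ, mass_succ] at h5
      linarith) ht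
  simp only [relaxation, sub_zero, zero_add] at this
  linarith

/-- As long as the mass is below `m`, level `m` is not full, so with threshold at most `m` all tasks
are eligible below level `m`. The mass thus follows `y' = lam - y` at least until saturation. -/
theorem eventually_min_le_mass (h : FluidSequence α lam x A L pre S dep q l) {s₀ T v : ℝ} {m : ℕ}
    (hs₀ : 0 ≤ s₀) (hL : ∀ᶠ n : ℕ in atTop, ∀ t ∈ Set.Icc s₀ T, L n (A n t) ≤ m)
    (hv : v ≤ lam) (hmass : ∀ᶠ n : ℕ in atTop, v ≤ mass (x n s₀) m) {ε : ℝ} (hε : 0 < ε) :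
    ∀ᶠ n : ℕ in atTop, ∀ t ∈ Set.Icc s₀ T,
      min (relaxation 1 lam (v - lam) s₀ t) m - ε ≤ mass (x n t) m := by
  have hκ0 : 0 < ε / 2 := by positivity
  filter_upwards [hL, hmass, h.eventually_abs_mass_sub_le m T hκ0,
    h.eventually_le_increment_of_eligible m T hκ0, eventually_ge_atTop 1] with n h1 h2 h3 h4 hn t ht
  have hd := h.dynamics n hn
  set p := relaxation 1 lam (v - lam) s₀ with hp
  have hpmono : ∀ s t, s ≤ t → p s ≤ p t := by
    intro s t hst
    have : Real.exp (-(1 * (t - s₀))) ≤ Real.exp (-(1 * (s - s₀))) := by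
      apply Real.exp_le_exp.2; linarith
    simp only [hp, relaxation]
    nlinarith
  -- As `v ≤ lam`, the curve increases, so truncation only reduces the growth to be matched.
  have hmin : ∀ s t, s ≤ t → min (p t) (m : ℝ) - min (p s) m ≤ p t - p s := by
    intro s t hst
    have := hpmono s t hst
    rcases le_total (p s) (m : ℝ) with hc | hc
    · rw [min_eq_left hc]; linarith [min_le_left (p t) (m : ℝ)]
    · rw [min_eq_right hc]; linarith [min_le_right (p t) (m : ℝ)]
  have hKC : 0 ≤ lam + m + |v - lam| := by have := h.lam_pos; positivity
  have key := neg_le_of_barrier (f := fun t => mass (x n t) m - min (p t) m) (a := s₀) (b := T)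
    (K := lam + m + |v - lam|) (ε := ε / 2) hKC hκ0.le (by
      have : min (p s₀) (m : ℝ) ≤ v := (min_le_left _ _).trans (by
        rw [hp, relaxation_self]; linarith)
      linarith)
    (fun s t hs hst ht => by
      have h5 := (abs_le.1 (h3 s t (hs₀.trans hs) hst ht)).1
      have h6 := (abs_le.1 (abs_relaxation_sub_le (ρ := 1) (c := lam) (d := v - lam)
        zero_le_one hs hst)).2
      have h7 := hmin s t hst
      linarith)
    (fun s t hs hst ht hneg => by
      have hneg' : ∀ r ∈ Set.Icc s t, mass (x n r) m < min (p r) m := fun r hr => by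
        have := hneg r hr; linarith
      have h5 := h4 s t (hs₀.trans hs) hst ht fun r hr => by
        have hr' : r ∈ Set.Icc s t := ⟨hr.1, hr.2.le⟩
        have hLr := h1 r ⟨hs.trans hr.1, hr.2.le.trans ht⟩
        rcases hLr.lt_or_eq with hlt | heq
        · exact Or.inl hlt
        · refine Or.inr ⟨heq, ?_⟩
          have hmem := hd.mem r (by linarith [hr.1])
          refine lt_of_le_of_ne (occupancySpace_le_one hmem m) fun hone => ?_
          have h6 := mul_le_mass hmem m
          rw [hone, mul_one] at h6
          linarith [hneg' r hr', min_le_right (p r) (m : ℝ)]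
      have h6 := hd.outflow_le m (hs₀.trans hs) hst
        ((continuous_relaxation 1 lam (v - lam) s₀).intervalIntegrable s t) fun r hr =>
          (hneg' r hr).le.trans (min_le_left _ _)
      have h7 := relaxation_sub 1 lam (v - lam) s₀ s t
      have h8 := hmin s t hst
      simp only [hp] at h8 ⊢
      linarith) ht
  linarith

/-! ### Settling of the threshold -/

/-- A threshold below `m` throughout a period `δ` would add about `(lam - m) * δ` to a mass that is
already nearly maximal. Once `m` is reached, level `m` stays above `α` and prevents any decrease. -/
theorem eventually_threshold_eq (h : FluidSequence α lam x A L pre S dep q l) {r T δ : ℝ} {m : ℕ}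
    (hr : 0 ≤ r) (hδ : 0 < δ) (hm : (m : ℝ) < lam)
    (hL : ∀ᶠ n : ℕ in atTop, ∀ t ∈ Set.Icc r T, L n (A n t) ≤ m)
    (hmass : ∀ ε : ℝ, 0 < ε → ∀ᶠ n : ℕ in atTop, ∀ t ∈ Set.Icc r T, m - ε ≤ mass (x n t) m) :
    ∀ᶠ n : ℕ in atTop, ∀ t ∈ Set.Icc (r + δ) T, L n (A n t) = m := by
  have hα := h.alpha_lt_one
  have hmδ : 0 < (lam - m) * δ := mul_pos (by linarith) hδ
  set κ : ℝ := min ((lam - m) * δ / 4) ((1 - α) / 2) with hκ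
  have hκ0 : 0 < κ := lt_min (by positivity) (by linarith)
  filter_upwards [hL, hmass κ hκ0, h.eventually_le_increment_of_eligible m T hκ0,
    eventually_ge_atTop 1] with n h1 h2 h3 hn t ht
  have hd := h.dynamics n hn
  have hrδ : r + δ ≤ T := ht.1.trans ht.2
  obtain ⟨s, hs, hsm⟩ : ∃ s ∈ Set.Ico r (r + δ), m ≤ L n (A n s) := by
    by_contra! hcon
    have h4 := h3 r (r + δ) hr (by linarith) hrδ fun s hs => Or.inl (hcon s hs)
    have h5 := hd.outflow_le_mul m hr (show r ≤ r + δ by linarith)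
    have h6 := h2 r ⟨le_rfl, by linarith⟩
    have h7 := mass_le (hd.mem (r + δ) (by linarith)) m
    have h8 : κ ≤ (lam - m) * δ / 4 := min_le_left _ _
    linarith
  have hst : s ≤ t := hs.2.le.trans ht.1
  have key : ∀ j, A n s ≤ j → j ≤ A n t → m ≤ L n j := by
    intro j hj
    induction j, hj using Nat.le_induction with
    | base => exact fun _ => hsm
    | succ j hj ih =>
      intro hjt
      have hmj := ih (by omega)
      by_contra hcon
      have hs1 := hd.le_succ_add_one j
      have hLj : L n j = m := by omega
      obtain ⟨r', hr0, hrt, -, hr'⟩ := hd.pre_eq m s t j (hr.trans hs.1) hj hjt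
      have h4 := hd.pre_le_of_down (show L n (j + 1) < L n j by omega)
      rw [hLj, hr' _ le_rfl] at h4
      have h5 := one_sub_le_of_mass_ge (hd.mem r' (by linarith [hs.1]))
        (h2 r' ⟨hs.1.trans hr0, by linarith [ht.2]⟩) le_rfl
      have h6 : κ ≤ (1 - α) / 2 := min_le_right _ _
      linarith
  exact le_antisymm (h1 t ⟨hs.1.trans hst, ht.2⟩) (key _ (hd.count_mono hst) le_rfl)

/-- The mass above level `m + 1` decays exponentially while the threshold is at most `m`. -/
theorem eventually_forall_mass_sub_le (h : FluidSequence α lam x A L pre S dep q l) {s₀ T : ℝ}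
    {m : ℕ} (hs₀ : 0 ≤ s₀) (hT : 0 ≤ T)
    (hL : ∀ᶠ n : ℕ in atTop, ∀ t ∈ Set.Icc s₀ T, L n (A n t) ≤ m) {ε : ℝ} (hε : 0 < ε) :
    ∀ᶠ M : ℕ in atTop, ∀ᶠ n : ℕ in atTop, ∀ t ∈ Set.Icc s₀ T,
      mass (x n t) M - mass (x n t) (m + 1) ≤
        (mass (x n s₀) M - mass (x n s₀) (m + 1)) * Real.exp (-(t - s₀)) + ε := by
  set κ : ℝ := ε / 5 with hκ
  have hκ0 : 0 < κ := by positivity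
  filter_upwards [h.eventually_forall_abs_mass_sub_le hT hκ0] with M hM
  filter_upwards [hM, hL, h.eventually_increment_le M T hκ0,
    h.eventually_le_increment_of_eligible (m + 1) T hκ0, h.eventually_abs_mass_sub_le M T hκ0,
    h.eventually_abs_mass_sub_le (m + 1) T hκ0, eventually_ge_atTop 1]
    with n h1 h2 h3 h4 h5 h6 hn t ht
  have hd := h.dynamics n hn
  set W := fun t => mass (x n t) M - mass (x n t) (m + 1) with hW
  have hKC : 0 ≤ (lam + M) + (lam + ((m + 1 : ℕ) : ℝ)) := by have := h.lam_pos; positivity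
  -- `W` gains almost nothing because all tasks are eligible below level `m + 1`, and it drains at
  -- rate at least `W` up to the tail. The centre is `-0` to match `relaxation_neg`.
  have key := relaxation_le_of_barrier (F := fun t => -W t + κ) (ρ := 1) (c := -0) (d := -W s₀)
    (a := s₀) (b := T) (ε := 2 * κ) zero_le_one hKC (by positivity) (by linarith)
    (fun s t hs hst ht => by
      have h7 := (abs_le.1 (h5 s t (hs₀.trans hs) hst ht)).2
      have h8 := (abs_le.1 (h6 s t (hs₀.trans hs) hst ht)).1
      simp only [hW]
      linarith)
    (fun s t hs hst ht hlt => by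
      have h7 := h3 s t (hs₀.trans hs) hst ht
      have h8 := h4 s t (hs₀.trans hs) hst ht fun r hr =>
        Or.inl (Nat.lt_succ_of_le (h2 r ⟨hs.trans hr.1, hr.2.le.trans ht⟩))
      have hint := (continuous_relaxation 1 0 (W s₀) s₀).intervalIntegrable (μ := volume) s t
      have h9 : ∫ u in s..t, relaxation 1 0 (W s₀) s₀ u ≤
          outflow (x n) M s t - outflow (x n) (m + 1) s t := by
        rw [outflow, outflow, ← intervalIntegral.integral_sub
          (hd.intervalIntegrable_outflow M (hs₀.trans hs) hst)
          (hd.intervalIntegrable_outflow (m + 1) (hs₀.trans hs) hst)]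
        refine intervalIntegral.integral_mono_on hst hint
          ((hd.intervalIntegrable_outflow M (hs₀.trans hs) hst).sub
            (hd.intervalIntegrable_outflow (m + 1) (hs₀.trans hs) hst)) fun u hu => ?_
        have h10 := hlt u hu
        have hu0 : 0 ≤ u := hs₀.trans (hs.trans hu.1)
        have h11 := (h1 u ⟨hu0, hu.2.trans ht⟩).2
        have h12 : 0 ≤ ((m + 1 : ℕ) : ℝ) * x n u (m + 1 + 1) :=
          mul_nonneg (by positivity) ((hd.mem u hu0).2 _).1
        rw [relaxation_neg] at h10
        simp only [hW] at h10 ⊢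
        linarith
      simp only [relaxation_neg, intervalIntegral.integral_neg]
      simp only [hW] at h9 ⊢
      linarith) ht
  rw [relaxation_neg] at key
  simp only [relaxation, zero_add, one_mul] at key
  simp only [hW] at key
  linarith

end FluidSequence

/-! ### The settling time -/

/-- The time after which the limiting threshold is at most `m`. -/
noncomputable def onsetBound (α lam : ℝ) (m : ℕ) (u : ℝ) : ℝ :=
  if u ≤ lam then 0 else max (Real.log ((u - lam) / (α * ((m + 1 : ℕ) : ℝ) - lam))) 0

theorem onsetBound_nonneg (α lam : ℝ) (m : ℕ) (u : ℝ) : 0 ≤ onsetBound α lam m u := by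
  unfold onsetBound
  split_ifs
  · exact le_rfl
  · exact le_max_right _ _

/-- When the logarithm is positive, the onset is the time at which the limiting total mass meets `α
* (m + 1)`. The sign of `δ` is free: a negative value gives a bound shortly before the onset. -/
theorem relaxation_le_of_onsetBound_add_le {α lam u δ t : ℝ} {m : ℕ}
    (hβ : lam < α * ((m + 1 : ℕ) : ℝ)) (ht : onsetBound α lam m u + δ ≤ t) :
    relaxation 1 lam (u - lam) 0 t ≤
      lam + Real.exp (-δ) * (α * ((m + 1 : ℕ) : ℝ) - lam) := by
  set β := α * ((m + 1 : ℕ) : ℝ) - lam with hβdef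
  have hβ0 : 0 < β := by linarith
  simp only [relaxation, one_mul, sub_zero]
  rcases le_or_gt u lam with hu | hu
  · have h1 : (u - lam) * Real.exp (-t) ≤ 0 :=
      mul_nonpos_of_nonpos_of_nonneg (by linarith) (Real.exp_pos _).le
    have h2 : 0 ≤ Real.exp (-δ) * β := by positivity
    linarith
  · have hu0 : 0 < u - lam := by linarith
    have h1 : Real.log ((u - lam) / β) ≤ onsetBound α lam m u := by
      rw [onsetBound, if_neg (not_le.2 hu)]; exact le_max_left _ _
    have h2 : Real.exp (-t) ≤ Real.exp (-δ) * (β / (u - lam)) := by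
      calc Real.exp (-t) ≤ Real.exp (-δ + -Real.log ((u - lam) / β)) :=
            Real.exp_le_exp.2 (by linarith)
        _ = Real.exp (-δ) * (β / (u - lam)) := by
          rw [Real.exp_add, Real.exp_neg (Real.log _), Real.exp_log (by positivity), inv_div]
    have h3 := mul_le_mul_of_nonneg_left h2 hu0.le
    have h4 : (u - lam) * (Real.exp (-δ) * (β / (u - lam))) = Real.exp (-δ) * β := by
      field_simp
    linarith

theorem relaxation_le_max {lam u t : ℝ} (ht : 0 ≤ t) :
    relaxation 1 lam (u - lam) 0 t ≤ max u lam := by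
  simp only [relaxation, one_mul, sub_zero]
  have h1 : Real.exp (-t) ≤ 1 := Real.exp_le_one_iff.2 (by linarith)
  have h0 := Real.exp_pos (-t)
  rcases le_total u lam with h | h
  · rw [max_eq_right h]; nlinarith
  · rw [max_eq_left h]; nlinarith

theorem totalMass_eq_of_apply_two_eq_zero {q : ℕ → ℝ} (hq : q ∈ occupancySpace) (h : q 2 = 0) :
    totalMass q = q 1 := by
  rw [totalMass, tsum_eq_single 0]
  intro i hi
  refine le_antisymm ?_ (hq.2 _).1
  rw [← h]
  exact occupancySpace_antitone hq (by omega)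

theorem totalMass_eq_zero_of_apply_one_eq_zero {q : ℕ → ℝ} (hq : q ∈ occupancySpace)
    (h : q 1 = 0) : totalMass q = 0 := by
  have h2 : q 2 = 0 := le_antisymm (h ▸ (hq.2 1).2) (hq.2 2).1
  rw [totalMass_eq_of_apply_two_eq_zero hq h2, h]

namespace FluidSequence

variable {α lam : ℝ} {x : ℕ → ℝ → ℕ → ℝ} {A : ℕ → ℝ → ℕ} {L : ℕ → ℕ → ℕ}
  {pre : ℕ → ℕ → ℕ → ℝ} {S : ℕ → ℕ → ℕ → ℝ} {dep : ℕ → ℕ → ℝ → ℝ} {q : ℕ → ℝ} {l : ℕ}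

/-- By monotonicity, `(m + 1) * x (m + 1)` is at most the mass, which follows the curve. -/
theorem eventually_apply_le_of_relaxation_le (h : FluidSequence α lam x A L pre S dep q l)
    {s₀ T c κ : ℝ} {m : ℕ} (hT : 0 ≤ T) (hs₀ : 0 ≤ s₀) (hκ : 0 < κ)
    (hp : ∀ t ∈ Set.Icc s₀ T,
      relaxation 1 lam (totalMass q - lam) 0 t ≤ c * ((m + 1 : ℕ) : ℝ) - κ) :
    ∀ᶠ n : ℕ in atTop, ∀ t ∈ Set.Icc s₀ T, x n t (m + 1) ≤ c := by
  obtain ⟨M, hM, hMm⟩ := ((h.eventually_forall_abs_mass_sub_le hT hκ).and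
    (eventually_ge_atTop (m + 1))).exists
  filter_upwards [hM, eventually_ge_atTop 1] with n h1 hn t ht
  have hmem := (h.dynamics n hn).mem t (hs₀.trans ht.1)
  have h2 := (abs_le.1 (h1 t ⟨hs₀.trans ht.1, ht.2⟩).1).2
  have h3 := mul_le_mass hmem (m + 1)
  have h4 := mass_mono hmem hMm
  have h5 := hp t ht
  have h6 : (0 : ℝ) < ((m + 1 : ℕ) : ℝ) := by positivity
  by_contra! hlt
  nlinarith

theorem eventually_threshold_le_of_onset (h : FluidSequence α lam x A L pre S dep q l)
    {T δ : ℝ} {m : ℕ} (hT : 0 ≤ T) (hδ : 0 < δ) (hβ : lam < α * ((m + 1 : ℕ) : ℝ)) :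
    ∀ᶠ n : ℕ in atTop, ∀ t ∈ Set.Icc (onsetBound α lam m (totalMass q) + δ) T,
      L n (A n t) ≤ m := by
  have h0 := onsetBound_nonneg α lam m (totalMass q)
  have hexp : Real.exp (-(δ / 2)) < 1 := Real.exp_lt_one_iff.2 (by linarith)
  have hx := h.eventually_apply_le_of_relaxation_le (m := m) (c := α)
    (s₀ := onsetBound α lam m (totalMass q) + δ / 2)
    (κ := (1 - Real.exp (-(δ / 2))) * (α * ((m + 1 : ℕ) : ℝ) - lam)) hT (by linarith)
    (mul_pos (by linarith) (by linarith)) fun t ht => by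
      have := relaxation_le_of_onsetBound_add_le hβ ht.1
      linarith
  -- The first half of `δ` makes the bound on level `m + 1` strict; the second lets the threshold
  -- come down.
  have := h.eventually_threshold_le (δ := δ / 2) (by linarith) (by linarith) hx
  rwa [add_assoc, add_halves] at this

theorem eventually_le_mass_of_onset (h : FluidSequence α lam x A L pre S dep q l)
    {T : ℝ} {m : ℕ} (hT : 0 ≤ T) (hm : (m : ℝ) < lam) (hβ : lam < α * ((m + 1 : ℕ) : ℝ))
    {ε : ℝ} (hε : 0 < ε) :
    ∀ᶠ n : ℕ in atTop, ∀ t ∈ Set.Icc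
      (onsetBound α lam m (totalMass q) + Real.log (lam / (lam - m))) T,
      m - ε ≤ mass (x n t) m := by
  have h0 := onsetBound_nonneg α lam m (totalMass q)
  set t₁ := onsetBound α lam m (totalMass q)
  rcases Nat.eq_zero_or_pos m with rfl | hpos
  · filter_upwards with n t ht
    simp [mass, hε.le]
  have hm1 : (1 : ℝ) ≤ m := by exact_mod_cast hpos
  have hlog : 0 < Real.log (lam / (lam - m)) :=
    Real.log_pos (by rw [one_lt_div (by linarith)]; linarith)
  have hcont : Tendsto (fun δ : ℝ => Real.exp δ * (lam - m)) (𝓝[>] 0) (𝓝 (lam - m)) := by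
    have : Continuous fun δ : ℝ => Real.exp δ * (lam - m) := by fun_prop
    simpa using (this.tendsto 0).mono_left nhdsWithin_le_nhds
  -- Filling starts from zero only at `t₁ + δ`; the delay multiplies the remaining gap by `exp δ`,
  -- which costs at most `ε / 2`.
  obtain ⟨δ, hδe, hδ0, hδl⟩ := ((hcont.eventually_le_const
    (show lam - m < lam - m + ε / 2 by linarith)).and (Ioo_mem_nhdsGT hlog)).exists
  have hL := h.eventually_threshold_le_of_onset (T := T) hT hδ0 hβ
  have hB := h.eventually_min_le_mass (s₀ := t₁ + δ) (v := 0) (by linarith) hL h.lam_pos.le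
    (by
      filter_upwards [eventually_ge_atTop 1] with n hn
      exact mass_nonneg ((h.dynamics n hn).mem _ (by linarith)) m) (half_pos hε)
  filter_upwards [hB] with n h1 t ht
  have h2 := h1 t ⟨by linarith [ht.1], ht.2⟩
  have h3 : lam - Real.exp δ * (lam - m) ≤ relaxation 1 lam (0 - lam) (t₁ + δ) t := by
    have e1 : Real.exp (-(t - (t₁ + δ))) ≤ Real.exp δ * ((lam - m) / lam) := by
      calc Real.exp (-(t - (t₁ + δ))) ≤ Real.exp (δ + -Real.log (lam / (lam - m))) :=
            Real.exp_le_exp.2 (by linarith [ht.1])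
        _ = Real.exp δ * ((lam - m) / lam) := by
          rw [Real.exp_add, Real.exp_neg, Real.exp_log (div_pos h.lam_pos (by linarith)), inv_div]
    have e2 := mul_le_mul_of_nonneg_left e1 h.lam_pos.le
    have e3 : lam * (Real.exp δ * ((lam - m) / lam)) = Real.exp δ * (lam - m) := by
      have := h.lam_pos.ne'
      field_simp
    simp only [relaxation, one_mul]
    linarith
  have h4 : (m : ℝ) - ε / 2 ≤ min (relaxation 1 lam (0 - lam) (t₁ + δ) t) m :=
    le_min (by linarith) (by linarith)
  linarith

/-- If the limiting initial state is not empty, then level `m` saturates strictly before the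
settling time. -/
theorem exists_lt_eventually_le_mass (h : FluidSequence α lam x A L pre S dep q l)
    {T : ℝ} {m : ℕ} (hT : 0 ≤ T) (hm1 : 1 ≤ m) (hm : (m : ℝ) < lam)
    (hβ : lam < α * ((m + 1 : ℕ) : ℝ)) (hq : 0 < q 1) :
    ∃ r, onsetBound α lam m (totalMass q) < r ∧
      r < onsetBound α lam m (totalMass q) + Real.log (lam / (lam - m)) ∧
      ∀ ε : ℝ, 0 < ε → ∀ᶠ n : ℕ in atTop, ∀ t ∈ Set.Icc r T, m - ε ≤ mass (x n t) m := by
  have h0 := onsetBound_nonneg α lam m (totalMass q)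
  set t₁ := onsetBound α lam m (totalMass q)
  have hlam := h.lam_pos
  have hm1' : (1 : ℝ) ≤ m := by exact_mod_cast hm1
  have hlm : 0 < lam - m := by linarith
  have hlog : 0 < Real.log (lam / (lam - m)) :=
    Real.log_pos (by rw [one_lt_div hlm]; linarith)
  -- Level one decays at rate at most one, so at time `t₁ + δ` with `δ ≤ 1` it is at least `2 * v -
  -- v`, one `v` being spent on the error.
  set v := q 1 * Real.exp (-(t₁ + 1)) / 2 with hv
  have hv0 : 0 < v := by positivity
  have hq1 := occupancySpace_le_one h.mem 1
  have hv1 : v ≤ 1 := by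
    have := Real.exp_le_one_iff.2 (show -(t₁ + 1) ≤ 0 by linarith)
    rw [hv]
    nlinarith [Real.exp_pos (-(t₁ + 1))]
  set w := Real.log (lam / (lam - v)) with hw
  have hlv : 0 < lam - v := by linarith
  have hw0 : 0 < w := Real.log_pos (by rw [one_lt_div hlv]; linarith)
  -- The head start `w` is the time to fill from zero to `v`. It covers both the delay `δ` at the
  -- start and the advance `δ` at the end.
  set δ := min (min (w / 2) (Real.log (lam / (lam - m)) / 4)) 1 with hδ
  have hδ0 : 0 < δ := lt_min (lt_min (by linarith) (by linarith)) one_pos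
  have hδw : δ ≤ w / 2 := (min_le_left _ _).trans (min_le_left _ _)
  have hδl : δ ≤ Real.log (lam / (lam - m)) / 4 := (min_le_left _ _).trans (min_le_right _ _)
  have hδ1 : δ ≤ 1 := min_le_right _ _
  refine ⟨t₁ + Real.log (lam / (lam - m)) - δ, by linarith, by linarith, fun ε hε => ?_⟩
  rcases lt_or_ge T (t₁ + Real.log (lam / (lam - m)) - δ) with hTr | hTr
  · filter_upwards with n t ht
    linarith [ht.1, ht.2]
  have hL := h.eventually_threshold_le_of_onset (T := T) hT hδ0 hβ
  have hmass : ∀ᶠ n : ℕ in atTop, v ≤ mass (x n (t₁ + δ)) m := by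
    filter_upwards [h.eventually_le_apply 0 T hv0, eventually_ge_atTop 1] with n h1 hn
    have h2 := h1 (t₁ + δ) ⟨by linarith, by linarith⟩
    have hmem := (h.dynamics n hn).mem (t₁ + δ) (by linarith)
    have h3 : x n (t₁ + δ) 1 ≤ mass (x n (t₁ + δ)) m := by
      have := mass_mono hmem hm1
      simpa [mass] using this
    have h4 : q 1 * Real.exp (-(t₁ + 1)) ≤ q 1 * Real.exp (-(t₁ + δ)) :=
      mul_le_mul_of_nonneg_left (Real.exp_le_exp.2 (by linarith)) hq.le
    simp only [zero_add, Nat.cast_one, one_mul] at h2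
    linarith
  have hB := h.eventually_min_le_mass (s₀ := t₁ + δ) (v := v) (by linarith) hL (by linarith)
    hmass hε
  filter_upwards [hB] with n h1 t ht
  have h2 := h1 t ⟨by linarith [ht.1], ht.2⟩
  have h3 : (m : ℝ) ≤ relaxation 1 lam (v - lam) (t₁ + δ) t := by
    have e1 : Real.exp (-(t - (t₁ + δ))) ≤ (lam - m) / (lam - v) := by
      calc Real.exp (-(t - (t₁ + δ))) ≤ Real.exp (w + -Real.log (lam / (lam - m))) :=
            Real.exp_le_exp.2 (by linarith [ht.1])
        _ = (lam - m) / (lam - v) := by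
          rw [Real.exp_add, Real.exp_neg, Real.exp_log (by positivity),
            Real.exp_log (by positivity)]
          field_simp
    have e2 := mul_le_mul_of_nonneg_left e1 hlv.le
    have e3 : (lam - v) * ((lam - m) / (lam - v)) = lam - m := by field_simp
    simp only [relaxation, one_mul]
    linarith
  rw [min_eq_right h3] at h2
  exact h2

/-- When `lam < 1`, the threshold is zero from the onset bound on, unless the initial state is
tight. -/
theorem eventually_threshold_eq_zero (h : FluidSequence α lam x A L pre S dep q l) {T : ℝ}
    (hT : 0 ≤ T) (hβ : lam < α) (hα0 : 0 < α) (hl : α < q l) (hl1 : q (l + 1) < 1)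
    (htight : ¬ (l = 1 ∧ q 2 = 0)) :
    ∀ᶠ n : ℕ in atTop, ∀ t ∈ Set.Icc (onsetBound α lam 0 (totalMass q)) T,
      L n (A n t) ≤ 0 := by
  have h0 := onsetBound_nonneg α lam 0 (totalMass q)
  set t₁ := onsetBound α lam 0 (totalMass q) with ht₁
  have hα1 := h.alpha_lt_one
  have hanti := occupancySpace_antitone h.mem
  have hu1 : q 1 ≤ totalMass q := by
    simpa [mass] using mass_le_totalMass h.mem h.summable 1
  rcases (h.mem.2 2).1.eq_or_lt' with h2 | h2
  · have hl0 : l = 0 := by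
      by_contra hne
      have : 2 ≤ l := by
        by_contra hlt
        exact htight ⟨by omega, h2⟩
      linarith [hanti this]
    have hu : totalMass q = q 1 := totalMass_eq_of_apply_two_eq_zero h.mem h2
    rw [hl0, zero_add] at hl1
    set c := max (totalMass q) lam with hc
    have hc1 : c < 1 := max_lt (hu ▸ hl1) (by linarith)
    have hx := h.eventually_apply_le_of_relaxation_le (m := 0) (T := T) (s₀ := 0)
      (c := (1 + c) / 2) (κ := (1 - c) / 2) hT le_rfl (by linarith) fun t ht => by
        have := relaxation_le_max (lam := lam) (u := totalMass q) ht.1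
        push_cast
        linarith
    filter_upwards [h.eventually_threshold_le_of_init (by linarith) hl0.le hx] with n h1 t ht
    exact h1 t ⟨h0.trans ht.1, ht.2⟩
  -- Level two stays at least `4 * κ - κ` up to time `T`. So level one is at most `α` already when
  -- the limiting total mass is at most `α + κ`, which leaves room before the onset.
  · set κ := q 2 * Real.exp (-(2 * T)) / 4 with hκ
    have hκ0 : 0 < κ := by positivity
    have hx : ∀ s₀, 0 ≤ s₀ → (∀ t ∈ Set.Icc s₀ T,
        relaxation 1 lam (totalMass q - lam) 0 t ≤ α + κ) →
        ∀ᶠ n : ℕ in atTop, ∀ t ∈ Set.Icc s₀ T, x n t (0 + 1) ≤ α := by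
      intro s₀ hs₀ hp
      obtain ⟨M, hM, hMm⟩ := ((h.eventually_forall_abs_mass_sub_le hT hκ0).and
        (eventually_ge_atTop 2)).exists
      filter_upwards [hM, h.eventually_le_apply 1 T hκ0, eventually_ge_atTop 1] with n h3 h4 hn t ht
      have ht0 : t ∈ Set.Icc 0 T := ⟨hs₀.trans ht.1, ht.2⟩
      have hmem := (h.dynamics n hn).mem t ht0.1
      have h5 := (abs_le.1 (h3 t ht0).1).2
      have h6 := mass_mono hmem hMm
      have h7 : mass (x n t) 2 = x n t 1 + x n t 2 := by simp [mass, Finset.sum_range_succ]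
      have h8 := h4 t ht0
      have h9 : q 2 * Real.exp (-(2 * T)) ≤ q 2 * Real.exp (-(2 * t)) :=
        mul_le_mul_of_nonneg_left (Real.exp_le_exp.2 (by linarith [ht.2])) h2.le
      norm_num at h8
      have h10 := hp t ht
      rw [zero_add]
      linarith
    have hβ' : lam < α * ((0 + 1 : ℕ) : ℝ) := by simpa using hβ
    rcases h0.eq_or_lt' with hz | hpos
    -- A zero onset means that the initial mass is at most `α`, so `α < q l` forces the threshold to
    -- be zero from the start.
    · have huα : totalMass q ≤ α := by
        by_contra! hlt
        have hpos : 0 < Real.log ((totalMass q - lam) / (α * ((0 + 1 : ℕ) : ℝ) - lam)) := by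
          refine Real.log_pos ?_
          rw [one_lt_div (by linarith)]
          push_cast
          linarith
        rw [ht₁, onsetBound, if_neg (by linarith)] at hz
        linarith [le_max_left (Real.log ((totalMass q - lam) / (α * ((0 + 1 : ℕ) : ℝ) - lam))) 0]
      have hl0 : l = 0 := by
        by_contra hne
        linarith [hanti (show 1 ≤ l by omega)]
      have := h.eventually_threshold_le_of_init (T := T) hα1 hl0.le (hx 0 le_rfl fun t ht => by
        have := relaxation_le_max (lam := lam) (u := totalMass q) ht.1
        have : max (totalMass q) lam ≤ α := max_le huα hβ.le
        linarith)
      rwa [hz]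
    · have hcont : Tendsto (fun δ : ℝ => Real.exp δ * (α - lam)) (𝓝[>] 0) (𝓝 (α - lam)) := by
        have : Continuous fun δ : ℝ => Real.exp δ * (α - lam) := by fun_prop
        simpa using (this.tendsto 0).mono_left nhdsWithin_le_nhds
      obtain ⟨δ, hδe, hδ0, hδt⟩ := ((hcont.eventually_le_const
        (show α - lam < α - lam + κ by linarith)).and (Ioo_mem_nhdsGT hpos)).exists
      have := h.eventually_threshold_le (s₀ := t₁ - δ) (T := T) (m := 0) (by linarith) hδ0
        (hx (t₁ - δ) (by linarith) fun t ht => by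
          have := relaxation_le_of_onsetBound_add_le (u := totalMass q) (δ := -δ) (t := t) hβ'
            (by linarith [ht.1])
          rw [neg_neg] at this
          norm_num at this
          linarith)
      rwa [sub_add_cancel] at this

end FluidSequence

/-! ### Exponential approach to the even load -/

namespace FluidSequence

variable {α lam : ℝ} {x : ℕ → ℝ → ℕ → ℝ} {A : ℕ → ℝ → ℕ} {L : ℕ → ℕ → ℕ}
  {pre : ℕ → ℕ → ℕ → ℝ} {S : ℕ → ℕ → ℕ → ℝ} {dep : ℕ → ℕ → ℝ → ℝ} {q : ℕ → ℝ} {l : ℕ}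

/-- After the settling time, the occupancies above level `m` approach their equilibrium values
exponentially fast. -/
theorem eventually_abs_sub_mul_exp_le (h : FluidSequence α lam x A L pre S dep q l) {T : ℝ} {m : ℕ}
    (hT : 0 ≤ T) (hm : (m : ℝ) < lam) (hβ : lam < α * ((m + 1 : ℕ) : ℝ)) {i : ℕ} (hi : m + 1 ≤ i) :
    ∀ᶠ n : ℕ in atTop, ∀ t ∈ Set.Icc
      (onsetBound α lam m (totalMass q) + Real.log (lam / (lam - m))) T,
      |x n t i - if i = m + 1 then lam - m else 0| * Real.exp
        (t - (onsetBound α lam m (totalMass q) + Real.log (lam / (lam - m)))) ≤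
        3 * (|totalMass q| + lam) + 3 := by
  have h0 := onsetBound_nonneg α lam m (totalMass q)
  set t₁ := onsetBound α lam m (totalMass q)
  set w := Real.log (lam / (lam - m))
  have hm0 : (0 : ℝ) ≤ m := by positivity
  have hlam := h.lam_pos
  have hw0 : 0 ≤ w := Real.log_nonneg (by rw [one_le_div (by linarith)]; linarith)
  set u := totalMass q
  have hu0 : 0 ≤ u := tsum_nonneg fun i => (h.mem.2 (i + 1)).1
  -- Before `t₁ + δ` the weight `E` is at most `exp δ = 2` and the crude mass bound suffices;
  -- afterwards the mass above level `m + 1` decays.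
  set δ := Real.log 2
  have hδ0 : 0 < δ := Real.log_pos (by norm_num)
  have hδ2 : Real.exp δ = 2 := Real.exp_log (by norm_num)
  -- The weight is at most `exp T`, so each error contributes at most `1 / 12` after weighting.
  set ε := Real.exp (-T) / 12 with hε
  have hε0 : 0 < ε := by positivity
  have hεT : ε * Real.exp T = 1 / 12 := by
    rw [hε, Real.exp_neg]
    have := (Real.exp_pos T).ne'
    field_simp
  have hε1 : ε ≤ 1 / 12 := by
    have := Real.one_le_exp hT
    nlinarith
  have hL := h.eventually_threshold_le_of_onset (T := T) hT hδ0 hβ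
  obtain ⟨M, ⟨hM, hW⟩, hMi⟩ := (((h.eventually_forall_abs_mass_sub_le hT hε0).and
    (h.eventually_forall_mass_sub_le (by linarith) hT hL hε0)).and (eventually_ge_atTop i)).exists
  filter_upwards [hM, hW, h.eventually_le_mass_of_onset hT hm hβ hε0, eventually_ge_atTop 1]
    with n h1 h2 h3 hn t ht
  have hd := h.dynamics n hn
  have ht0 : 0 ≤ t := by linarith [ht.1]
  have hmem := hd.mem t ht0
  set E := Real.exp (t - (t₁ + w)) with hE
  have hE0 : 0 < E := Real.exp_pos _
  have hET : E ≤ Real.exp T := Real.exp_le_exp.2 (by linarith [ht.2])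
  have hEε : ε * E ≤ 1 / 12 := by
    rw [← hεT]; exact mul_le_mul_of_nonneg_left hET hε0.le
  have hmassle : ∀ s ∈ Set.Icc 0 T, mass (x n s) M - mass (x n s) (m + 1) ≤ u + lam + 1 := by
    intro s hs
    have h4 := (abs_le.1 (h1 s hs).1).2
    have h5 := relaxation_le_max (lam := lam) (u := u) hs.1
    have h6 := mass_nonneg (hd.mem s hs.1) (m + 1)
    have h7 : max u lam ≤ u + lam := max_le (by linarith) (by linarith)
    linarith
  have hWE : (mass (x n t) M - mass (x n t) (m + 1)) * E ≤ 2 * (u + lam + 1) + 1 / 12 := by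
    rcases lt_or_ge t (t₁ + δ) with hc | hc
    · have h4 : E ≤ 2 := by
        rw [← hδ2]; exact Real.exp_le_exp.2 (by linarith)
      have h5 := mul_le_mul_of_nonneg_right (hmassle t ⟨ht0, ht.2⟩) hE0.le
      have h6 := mul_le_mul_of_nonneg_left h4 (show 0 ≤ u + lam + 1 by linarith)
      linarith
    · have h4 := mul_le_mul_of_nonneg_right (h2 t ⟨hc, ht.2⟩) hE0.le
      have h5 : Real.exp (-(t - (t₁ + δ))) * E ≤ 2 := by
        rw [← hδ2, hE, ← Real.exp_add]
        exact Real.exp_le_exp.2 (by linarith)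
      have h6 := mul_le_mul_of_nonneg_right
        (hmassle (t₁ + δ) ⟨by linarith, by linarith [ht.2]⟩)
        (mul_nonneg (Real.exp_pos (-(t - (t₁ + δ)))).le hE0.le)
      have h7 := mul_le_mul_of_nonneg_left h5 (show 0 ≤ u + lam + 1 by linarith)
      linarith
  rw [abs_of_nonneg hu0]
  split_ifs with him
  · subst him
    -- The three parts are the relaxing total mass, the saturated lower levels and the draining
    -- upper levels.
    have h4 : x n t (m + 1) - (lam - m) = (mass (x n t) M - lam) - (mass (x n t) m - m)
        - (mass (x n t) M - mass (x n t) (m + 1)) := by rw [mass_succ]; ring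
    have h5 := abs_le.1 (h1 t ⟨ht0, ht.2⟩).1
    have h6 : |mass (x n t) M - lam| * E ≤ u + lam + 1 / 12 := by
      have h7 : |mass (x n t) M - lam| ≤ (u + lam) * Real.exp (-t) + ε := by
        have h8 := Real.exp_pos (-t)
        simp only [relaxation, one_mul, sub_zero] at h5
        rw [abs_le]
        constructor <;> nlinarith [h5.1, h5.2]
      have h8 : Real.exp (-t) * E ≤ 1 := by
        rw [hE, ← Real.exp_add, Real.exp_le_one_iff]; linarith
      have h9 := mul_le_mul_of_nonneg_right h7 hE0.le
      have h10 := mul_le_mul_of_nonneg_left h8 (show 0 ≤ u + lam by linarith)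
      linarith
    have h7 : |mass (x n t) m - m| * E ≤ 1 / 12 := by
      have h8 : |mass (x n t) m - m| ≤ ε := by
        rw [abs_le]
        constructor <;> linarith [h3 t ht, mass_le hmem m]
      exact (mul_le_mul_of_nonneg_right h8 hE0.le).trans hEε
    have h8 : 0 ≤ mass (x n t) M - mass (x n t) (m + 1) := sub_nonneg.2 (mass_mono hmem hMi)
    rw [h4]
    have h9 : |(mass (x n t) M - lam) - (mass (x n t) m - m)
        - (mass (x n t) M - mass (x n t) (m + 1))| ≤ |mass (x n t) M - lam| + |mass (x n t) m - m|
        + (mass (x n t) M - mass (x n t) (m + 1)) := by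
      refine (abs_sub _ _).trans ?_
      rw [abs_of_nonneg h8]
      have := abs_sub (mass (x n t) M - lam) (mass (x n t) m - m)
      linarith
    have h10 := mul_le_mul_of_nonneg_right h9 hE0.le
    linarith
  · have h4 : x n t i ≤ mass (x n t) M - mass (x n t) (m + 1) := by
      obtain ⟨k, rfl⟩ : ∃ k, i = k + 1 := ⟨i - 1, by omega⟩
      have h5 := mass_mono hmem hMi
      have h6 := mass_mono hmem (show m + 1 ≤ k by omega)
      rw [mass_succ] at h5
      linarith
    rw [sub_zero, abs_of_nonneg (hmem.2 i).1]
    have h5 := mul_le_mul_of_nonneg_right h4 hE0.le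
    linarith

end FluidSequence

/-! ### The limit theorem -/

theorem supAbs_le {f : ℝ → ℝ} {a b c : ℝ} (h : ∀ t ∈ Set.Icc a b, |f t| ≤ c) :
    supAbs f a b ≤ ENNReal.ofReal c :=
  iSup₂_le fun t ht => ENNReal.ofReal_le_ofReal (h t ht)

theorem tendsto_supAbs_zero {f : ℕ → ℝ → ℝ} {a b : ℝ}
    (h : ∀ ε : ℝ, 0 < ε → ∀ᶠ n in atTop, ∀ t ∈ Set.Icc a b, |f n t| ≤ ε) :
    Tendsto (fun n => supAbs (f n) a b) atTop (𝓝 0) := by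
  rw [ENNReal.tendsto_nhds_zero]
  intro ε hε
  rcases eq_or_ne ε ⊤ with rfl | htop
  · simp
  · filter_upwards [h ε.toReal (ENNReal.toReal_pos hε.ne' htop)] with n hn
    rw [← ENNReal.ofReal_toReal htop]
    exact supAbs_le hn

theorem tendsto_supAbs_natCast_sub {v : ℕ → ℝ → ℕ} {m : ℕ} {a b : ℝ}
    (h : ∀ᶠ n in atTop, ∀ t ∈ Set.Icc a b, v n t = m) :
    Tendsto (fun n => supAbs (fun t => (v n t : ℝ) - m) a b) atTop (𝓝 0) := by
  refine tendsto_supAbs_zero fun ε hε => ?_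
  filter_upwards [h] with n hn t ht
  rw [hn t ht, sub_self, abs_zero]
  exact hε.le

theorem fluidSequence_of_isSystemPath {α lam : ℝ} (hα1 : α < 1) (hlam : 0 < lam) {N : ℝ≥0 → ℕ}
    {D : ℕ → ℝ≥0 → ℕ} {U : ℕ → ℝ} {q : ℕ → ℝ → ℕ → ℝ} {ell : ℕ → ℝ → ℕ} {qlim : ℕ → ℝ}
    {elllim : ℕ} (hN : IsCountingPath N lam) (hD : ∀ i, IsCountingPath (D i) 1)
    (hU : ∀ j, U j ∈ Set.Ico (0 : ℝ) 1)
    (hpath : ∀ n, 1 ≤ n → IsSystemPath n α N D U (q n) (ell n))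
    (hmem : qlim ∈ occupancySpace) (hsum : Summable qlim)
    (hq : ∀ i, Tendsto (fun n => q n 0 i) atTop (𝓝 (qlim i)))
    (hell : Tendsto (fun n => ell n 0) atTop (𝓝 elllim)) :
    FluidSequence α lam q (fun n => arrivalCount n N) (fun n => thresholdAfter n α N (q n) (ell n))
      (fun n j => occupancyBefore (q n) (arrivalTime n N (j + 1)))
      (fun n a j => routedBelow (occupancyBefore (q n) (arrivalTime n N (j + 1)))
        (thresholdAfter n α N (q n) (ell n) j) a (U (j + 1)))
      (fun n => departuresBelow n D (q n)) qlim elllim where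
  dynamics := fun n hn => (hpath n hn).dynamics hN hD hn hU
  arrivals := by
    intro T ε hε
    filter_upwards [hN.eventually_abs_sub_le T ε hε, eventually_ge_atTop 1] with n h1 hn t ht
    have hn' : (0 : ℝ) < n := by exact_mod_cast hn
    have h2 := h1 (n * t.toNNReal) (by
      rw [NNReal.coe_mul, Real.coe_toNNReal _ ht.1, NNReal.coe_natCast]
      exact mul_le_mul_of_nonneg_left ht.2 hn'.le)
    rw [NNReal.coe_mul, Real.coe_toNNReal _ ht.1, NNReal.coe_natCast] at h2
    have h3 : 1 / (n : ℝ) * (arrivalCount n N t : ℝ) - lam * t =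
        (1 / (n : ℝ)) * ((N (n * t.toNNReal) : ℝ) - lam * (n * t)) := by
      rw [arrivalCount]; field_simp
    rw [h3, abs_mul, abs_of_pos (by positivity), one_div, inv_mul_le_iff₀ hn']
    linarith
  departures := by
    intro a T ε hε
    have hε' : 0 < ε / (a + 1) := by positivity
    have hev : ∀ᶠ n : ℕ in atTop, ∀ i ∈ Finset.range a, ∀ s : ℝ≥0,
        (s : ℝ) ≤ n * (((i + 1 : ℕ) : ℝ) * T) → |(D (i + 1) s : ℝ) - 1 * s| ≤ ε / (a + 1) * n :=
      (Finset.eventually_all _).2 fun i _ =>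
        (hD (i + 1)).eventually_abs_sub_le (((i + 1 : ℕ) : ℝ) * T) _ hε'
    filter_upwards [hev, eventually_ge_atTop 1] with n h1 hn t ht
    refine ((hpath n hn).abs_departuresBelow_sub_le hN hD hn
      (fun i hi => h1 i (Finset.mem_range.2 hi)) ht).trans ?_
    rw [mul_div_assoc', div_le_iff₀ (by positivity)]
    nlinarith
  init := hq
  init_threshold := by
    rw [nhds_discrete, tendsto_pure] at hell
    filter_upwards [hell] with n hn
    simp [thresholdAfter, hn]
  mem := hmem
  summable := hsum
  alpha_lt_one := hα1
  lam_pos := hlam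

end LoadBalancing

theorem mainTheorem10 (α lam : ℝ) (hα0 : 0 < α) (hα1 : α < 1) (hlam : 0 < lam)
    (hlam_int : ∀ k : ℕ, lam ≠ k) (hopt : lam / (⌊lam⌋₊ + 1) < α) :
    ∃ c : ℝ → ℝ, (∀ u, 0 < c u) ∧
      ∀ {Ω : Type*} [MeasurableSpace Ω] (P : Measure Ω) [IsProbabilityMeasure P]
        (N : ℝ≥0 → Ω → ℕ) (D : ℕ → ℝ≥0 → Ω → ℕ) (U : ℕ → Ω → ℝ)
        (q : ℕ → Ω → ℝ → ℕ → ℝ) (ell : ℕ → Ω → ℝ → ℕ)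
        (qlim : Ω → ℕ → ℝ) (elllim : Ω → ℕ),
        LoadBalancing.IsPoissonProcess N lam.toNNReal P →
        (∀ i, LoadBalancing.IsPoissonProcess (D i) 1 P) →
        (∀ j, Measurable (U j) ∧ pdf.IsUniform (U j) (Set.Ico 0 1) P volume) →
        (∀ n, 1 ≤ n → Measurable (fun ω => q n ω 0) ∧ Measurable (fun ω => ell n ω 0)) →
        iIndep (LoadBalancing.Source.sigma N D U (fun n ω => q n ω 0) (fun n ω => ell n ω 0)) P →
        (∀ n, 1 ≤ n → ∀ᵐ ω ∂P, LoadBalancing.IsSystemPath n α (fun t => N t ω)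
          (fun i t => D i t ω) (fun j => U j ω) (q n ω) (ell n ω)) →
        (∀ᵐ ω ∂P, qlim ω ∈ LoadBalancing.occupancySpace ∧ Summable (qlim ω)) →
        (∀ᵐ ω ∂P, ∀ i, Tendsto (fun n => q n ω 0 i) atTop (𝓝 (qlim ω i))) →
        (∀ᵐ ω ∂P, Tendsto (fun n => ell n ω 0) atTop (𝓝 (elllim ω))) →
        (∀ᵐ ω ∂P, α < qlim ω (elllim ω) ∧ qlim ω (elllim ω + 1) < 1) →
        ∀ᵐ ω ∂P, ∀ T,
          LoadBalancing.settlingBound α lam (LoadBalancing.totalMass (qlim ω)) ≤ T →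
          (¬ LoadBalancing.IsTightInitialState lam (qlim ω) (elllim ω) →
            Tendsto (fun n => LoadBalancing.supAbs (fun t => (ell n ω t : ℝ) - ⌊lam⌋₊)
              (LoadBalancing.settlingBound α lam (LoadBalancing.totalMass (qlim ω))) T)
              atTop (𝓝 0)) ∧
          (∀ δ, 0 < δ →
            Tendsto (fun n => LoadBalancing.supAbs (fun t => (ell n ω t : ℝ) - ⌊lam⌋₊)
              (LoadBalancing.settlingBound α lam (LoadBalancing.totalMass (qlim ω)) + δ) T)
              atTop (𝓝 0)) ∧
          (∀ i, i ≤ ⌊lam⌋₊ →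
            Tendsto (fun n =>
              LoadBalancing.supAbs (fun t => q n ω t i - LoadBalancing.evenLoad lam i)
                (LoadBalancing.settlingBound α lam (LoadBalancing.totalMass (qlim ω))) T)
              atTop (𝓝 0)) ∧
          (∀ i, ⌈lam⌉₊ ≤ i →
            limsup (fun n =>
              LoadBalancing.supAbs (fun t => (q n ω t i - LoadBalancing.evenLoad lam i) *
                  Real.exp (t -
                    LoadBalancing.settlingBound α lam (LoadBalancing.totalMass (qlim ω))))
                (LoadBalancing.settlingBound α lam (LoadBalancing.totalMass (qlim ω))) T)
              atTop
            ≤ ENNReal.ofReal (c (LoadBalancing.totalMass (qlim ω)))) := by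
  set m := ⌊lam⌋₊ with hmdef
  have hm : (m : ℝ) < lam := lt_of_le_of_ne (Nat.floor_le hlam.le) (hlam_int m).symm
  have hm1 : lam < m + 1 := Nat.lt_floor_add_one lam
  have hceil : ⌈lam⌉₊ = m + 1 := by
    rw [Nat.ceil_eq_iff (by omega)]
    simp only [add_tsub_cancel_right]
    exact ⟨hm, by push_cast; exact hm1.le⟩
  have hβ : lam < α * ((m + 1 : ℕ) : ℝ) := by
    rw [div_lt_iff₀ (by positivity)] at hopt
    push_cast
    exact hopt
  refine ⟨fun u => 3 * (|u| + lam) + 3, fun u => by positivity, ?_⟩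
  intro Ω _ P _ N D U q ell qlim elllim hN hD hU _ _ hpath hqlim hq0 hell0 hinit
  have hlam' : 0 < lam.toNNReal := Real.toNNReal_pos.2 hlam
  filter_upwards [hN.ae_isCountingPath hlam', ae_all_iff.2 fun i => (hD i).ae_isCountingPath one_pos,
    ae_all_iff.2 fun j => LoadBalancing.ae_mem_Ico_of_isUniform (hU j).1 (hU j).2,
    ae_all_iff.2 fun n => ae_all_iff.2 fun hn : 1 ≤ n => hpath n hn, hqlim, hq0, hell0, hinit]
    with ω hNω hDω hUω hpathω hqω hq0ω hell0ω hinitω T hT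
  rw [Real.coe_toNNReal _ hlam.le] at hNω
  simp only [NNReal.coe_one] at hDω
  have hfl := LoadBalancing.fluidSequence_of_isSystemPath hα1 hlam hNω hDω hUω hpathω hqω.1 hqω.2
    hq0ω hell0ω
  set u := LoadBalancing.totalMass (qlim ω) with hu
  have hsettle : LoadBalancing.settlingBound α lam u =
      LoadBalancing.onsetBound α lam m u + Real.log (lam / (lam - m)) := by
    rw [LoadBalancing.settlingBound, LoadBalancing.onsetBound, hceil]
    split_ifs <;> simp [hmdef]
  have hm0 : (0 : ℝ) ≤ m := by positivity
  have honset := LoadBalancing.onsetBound_nonneg α lam m u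
  have hlog0 : 0 ≤ Real.log (lam / (lam - m)) :=
    Real.log_nonneg (by rw [one_le_div (by linarith)]; linarith)
  rw [hsettle] at hT ⊢
  set τ := LoadBalancing.onsetBound α lam m u + Real.log (lam / (lam - m)) with hτ
  have hτ0 : 0 ≤ τ := by linarith
  have hT0 : 0 ≤ T := hτ0.trans hT
  have hellt : ∀ a : ℝ, 0 ≤ a → (∀ᶠ n : ℕ in atTop, ∀ t ∈ Set.Icc a T,
      LoadBalancing.thresholdAfter n α (fun t => N t ω) (q n ω) (ell n ω)
        (LoadBalancing.arrivalCount n (fun t => N t ω) t) = m) →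
      ∀ᶠ n : ℕ in atTop, ∀ t ∈ Set.Icc a T, ell n ω t = m := by
    intro a ha h
    filter_upwards [h, eventually_ge_atTop 1] with n hn hn1 t ht
    rw [(hpathω n hn1).threshold_eq_thresholdAfter (ha.trans ht.1)]
    exact hn t ht
  have hlogpos : 1 ≤ m → 0 < Real.log (lam / (lam - m)) := fun h1 => by
    have : (1 : ℝ) ≤ m := by exact_mod_cast h1
    exact Real.log_pos (by rw [one_lt_div (by linarith)]; linarith)
  have hmass := fun (ε : ℝ) (hε : 0 < ε) => hfl.eventually_le_mass_of_onset hT0 hm hβ hε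
  refine ⟨fun htight => ?_, fun δ hδ => ?_, fun i hi => ?_, fun i hi => ?_⟩
  · refine LoadBalancing.tendsto_supAbs_natCast_sub (hellt τ hτ0 ?_)
    -- For `m = 0` the filling time vanishes and the onset itself must be sharp; otherwise level `m`
    -- is full from some `r` strictly between the onset and the settling time.
    rcases Nat.eq_zero_or_pos m with hz | hpos
    · have hlam1 : lam < 1 := by rw [hz] at hm1; simpa using hm1
      have hβ0 : lam < α := by rw [hz] at hβ; simpa using hβ
      have hτz : τ = LoadBalancing.onsetBound α lam 0 u := by
        rw [hτ, hz]; simp [div_self hlam.ne']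
      have := hfl.eventually_threshold_eq_zero hT0 hβ0 hα0 hinitω.1 hinitω.2
        fun hc => htight (Or.inr ⟨hlam1, hc⟩)
      rw [hτz, hz]
      filter_upwards [this] with n hn t ht using Nat.le_zero.1 (hn t ht)
    · have hlam1 : 1 < lam := by
        have : (1 : ℝ) ≤ m := by exact_mod_cast hpos
        linarith
      have hq1 : 0 < qlim ω 1 := by
        refine lt_of_le_of_ne (hqω.1.2 1).1 fun hc => htight (Or.inl ⟨hlam1, ?_⟩)
        exact LoadBalancing.totalMass_eq_zero_of_apply_one_eq_zero hqω.1 hc.symm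
      obtain ⟨r, hr1, hr2, hr3⟩ := hfl.exists_lt_eventually_le_mass hT0 hpos hm hβ hq1
      have hL := hfl.eventually_threshold_le_of_onset (T := T) hT0 (sub_pos.2 hr1) hβ
      rw [add_sub_cancel] at hL
      have := hfl.eventually_threshold_eq (by linarith) (sub_pos.2 hr2) hm hL hr3
      rwa [add_sub_cancel] at this
  · refine LoadBalancing.tendsto_supAbs_natCast_sub (hellt (τ + δ) (by linarith) ?_)
    rcases Nat.eq_zero_or_pos m with hz | hpos
    -- Here the upper bound is already zero, so it determines the threshold.
    · have hL := hfl.eventually_threshold_le_of_onset (T := T) hT0 hδ hβ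
      filter_upwards [hL] with n hn t ht
      have := hn t ⟨by linarith [ht.1], ht.2⟩
      omega
    · have hL := hfl.eventually_threshold_le_of_onset (T := T) hT0 (hlogpos hpos) hβ
      exact hfl.eventually_threshold_eq hτ0 hδ hm hL hmass
  · refine LoadBalancing.tendsto_supAbs_zero fun ε hε => ?_
    filter_upwards [hmass ε hε, eventually_ge_atTop 1] with n h1 hn t ht
    have hmem := (hpathω n hn).mem_occupancySpace t (hτ0.trans ht.1)
    have h2 := LoadBalancing.one_sub_le_of_mass_ge hmem (h1 t ht) hi
    have h3 := LoadBalancing.occupancySpace_le_one hmem i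
    rw [LoadBalancing.evenLoad, if_pos hi, abs_le]
    constructor <;> linarith
  · rw [hceil] at hi
    refine limsup_le_of_le (by isBoundedDefault) ?_
    filter_upwards [hfl.eventually_abs_sub_mul_exp_le hT0 hm hβ hi] with n hn
    refine LoadBalancing.supAbs_le fun t ht => ?_
    rw [abs_mul, abs_of_pos (Real.exp_pos _), LoadBalancing.evenLoad, if_neg (by omega)]
    exact hn t ht
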